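/- Let $T_t$ be one of the following flows on a measure space $(X,\mu)$. (1) A special flow: $A\subset\mathbb R$ is a measurable set with a $\sigma$-finite measure $\nu$, $P:A\to A$ is an invertible bi-measurable $\nu$-preserving transformation, $r:A\to[0,\infty)$ is a measurable $\nu$-integrable function, $X=\{(a,b): a\in A,\ 0\le b<r(a)\}$ is the part of the plane under the graph of $r$, with the topology given by the planar metric $\rho$, $\mu$ is the restriction of $\nu\times\text{Lebesgue}$ to $X$, and $T_t$ moves a point $(a,b)$ vertically upward with unit speed, $T_t(a,b)=(a,b+t)$, where $(a,r(a))$ is identified with $(P(a),0)$. (2) A linear flow $T_t x=x+t\omega$, $\omega\in\mathbb R^d$, on the torus $X=\mathbb R^d/\mathbb Z^d$ with the Haar probability measure $\mu$. Suppose that $T_t$ is ergodic: every $T_t$ preserves $\mu$, and every measurable set that is invariant under all $T_t$ is null or has null complement. Let $f:X\to\mathbb R$ be $\mu$-integrable with $\int_X f\,d\mu=0$. Then for $\mu$-almost every $x\in X$ the function $s\mapsto f(T_sx)$ is integrable on every bounded interval, so that $\sigma(t,x)=\int_0^t f(T_sx)\,ds$ is defined for all $t\in\mathbb R$, and, if $f(x)\ne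 0$, there is a sequence $t_k\to+\infty$ such that $\sigma(t_k,x)=0$ for all $k$ and $T_{t_k}x\to x$ as $k\to\infty$ (in the planar metric in case (1), on the torus in case (2)). -/

import Mathlib

open MeasureTheory Filter Topology

/-- A flow `T` on the measure space `(X, μ)` is ergodic: every `T t` preserves `μ`, and every
measurable set that is invariant under all `T t` is null or has null complement. -/
structure IsErgodicFlow {X : Type*} [MeasurableSpace X] (T : ℝ → X → X) (μ : Measure X) :
    Prop where
  measurePreserving : ∀ t : ℝ, MeasurePreserving (T t) μ μ
  null_or_conull : ∀ s : Set X, MeasurableSet s → (∀ t : ℝ, T t ⁻¹' s = s) →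
    μ s = 0 ∨ μ sᶜ = 0

/-- The integral `σ(t, x) = ∫₀ᵗ f (T_s x) ds` of `f` along the trajectory of `x`. -/
noncomputable def orbitIntegral {X : Type*} (T : ℝ → X → X) (f : X → ℝ) (t : ℝ) (x : X) : ℝ :=
  ∫ s in (0 : ℝ)..t, f (T s x)

/-- The point `x` returns to itself with zero integrals: there are times `t k → +∞` such that
`σ(t k, x) = 0` for all `k` and `T_{t k} x → x`. -/
def ReturnsWithZeroIntegral {X : Type*} [TopologicalSpace X] (T : ℝ → X → X) (f : X → ℝ)
    (x : X) : Prop :=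
  ∃ t : ℕ → ℝ, Tendsto t atTop atTop ∧ (∀ k, orbitIntegral T f (t k) x = 0) ∧
    Tendsto (fun k => T (t k) x) atTop (𝓝 x)

namespace SpecialFlow

/-- The phase space of a special flow: the part of the plane under the graph of the roof function
`r : A → ℝ`, `A ⊆ ℝ`. The upper boundary points `(a, r a)` are left out, as they are identified
with points of the base. It carries the topology (and the Borel structure) of the plane. -/
abbrev PhaseSpace {A : Set ℝ} (r : A → ℝ) : Type :=
  {p : A × ℝ // 0 ≤ p.2 ∧ p.2 < r p.1}

/-- The measure on the phase space: the restriction of `ν × Lebesgue`. -/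
noncomputable def phaseMeasure {A : Set ℝ} (ν : Measure A) (r : A → ℝ) :
    Measure (PhaseSpace r) :=
  (ν.prod (volume : Measure ℝ)).comap Subtype.val

/-- The power `P ^ n`, `n ∈ ℤ`, of the base automorphism. -/
def basePow {A : Set ℝ} (P : A ≃ᵐ A) (n : ℤ) (a : A) : A :=
  ((P.toEquiv : Equiv.Perm A) ^ n) a

/-- The time at which the vertical trajectory that leaves `(a, 0)` at time `0` arrives at
`(P ^ n a, 0)`: it is `∑_{0 ≤ i < n} r (P ^ i a)` for `n ≥ 0` and `-∑_{n ≤ i < 0} r (P ^ i a)` for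
`n < 0`. -/
noncomputable def arrivalTime {A : Set ℝ} (P : A ≃ᵐ A) (r : A → ℝ) (n : ℤ) (a : A) : ℝ :=
  ∑ i ∈ Finset.Ico 0 n, r (basePow P i a) - ∑ i ∈ Finset.Ico n 0, r (basePow P i a)

open Classical in
/-- The special flow over `P` under `r`: a point `(a, b)` moves vertically upward with unit speed,
and jumps from `(a, r a)` to `(P a, 0)`. Thus `T_t (a, b) = (P ^ n a, b + t - s)`, where
`s` is the arrival time at `P ^ n a` and `n` is the integer (it is unique, as `r ≥ 0`) for which
this point lies in the phase space. Where no such `n` exists (the trajectory of the point is not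
defined up to the time `t`) the point is left in place. -/
noncomputable def flow {A : Set ℝ} (P : A ≃ᵐ A) (r : A → ℝ) (t : ℝ) (x : PhaseSpace r) :
    PhaseSpace r :=
  if h : ∃ n : ℤ, 0 ≤ x.1.2 + t - arrivalTime P r n x.1.1 ∧
      x.1.2 + t - arrivalTime P r n x.1.1 < r (basePow P n x.1.1) then
    ⟨(basePow P h.choose x.1.1, x.1.2 + t - arrivalTime P r h.choose x.1.1), h.choose_spec⟩
  else x

end SpecialFlow

/-- The linear flow (winding) `T_t x = x + t ω` on the torus `(ℝ / ℤ) ^ d`. -/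
noncomputable def torusFlow {d : ℕ} (ω : Fin d → ℝ) (t : ℝ) (x : UnitAddTorus (Fin d)) :
    UnitAddTorus (Fin d) :=
  fun i => x i + ((t * ω i : ℝ) : UnitAddCircle)

/-! The integrals form a cocycle, σ(s + t, x) = σ(s, x) + σ(t, T_s x), and three facts about it
combine.

Sublinear growth in mean. In L² the coboundaries g ∘ T_t - g span a dense subspace of the functions
of mean zero, by ergodicity, and their orbit integrals are bounded in mean. Approximation in L¹ then
gives ∫ |σ(t, ·)| dμ ≤ ε t + K for every ε > 0 (`lintegral_orbitIntegral_le`).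

Recurrence. Suppose that the values of the cocycle at the visits of each orbit to a set C are
η-separated. Few of the first n visits can have |σ| ≤ δ n, since an interval holds few separated
points, and |σ| > δ n is rare by Markov's inequality. So μ(C) = 0
(`measure_eq_zero_of_separated_cocycle`). Consequently almost every point of a set B returns to B at
arbitrarily late integer times with |σ| < η.

From small to zero. If f(x) > 0, Lebesgue differentiation along the orbit makes σ(·, x) change sign
across 0. Let B consist of the points y with σ(δ, y) > η and σ(-δ, y) < -η whose short orbit stays
near x. A return T_n x ∈ B with |σ(n, x)| < η forces a zero of σ(·, x) in (n - δ, n + δ), at a time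
when the orbit is near x. The case f(x) < 0 follows by passing to -f.

Torus flows satisfy the abstract hypotheses directly. Special flows do so after freezing the
incomplete orbits, which form a null set because the flow preserves a finite measure. Their orbits
are always right continuous, and continuous at time 0 off the null base. -/

/-- A jointly measurable action of `ℝ`. -/
structure IsMeasurableFlow {X : Type*} [MeasurableSpace X] (T : ℝ → X → X) : Prop where
  measurable : Measurable fun p : ℝ × X => T p.1 p.2
  zero_apply : ∀ x, T 0 x = x
  add_apply : ∀ s t x, T (s + t) x = T s (T t x)

theorem intervalIntegrable_orbit {X : Type*} {T : ℝ → X → X} {f : X → ℝ} {x : X}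
    (h : ∀ t, IntervalIntegrable (fun s => f (T s x)) volume 0 t) (a b : ℝ) :
    IntervalIntegrable (fun s => f (T s x)) volume a b :=
  (h a).symm.trans (h b)

/-! ### Measurable flows: Fubini along orbits -/

namespace IsMeasurableFlow

variable {X : Type*} [MeasurableSpace X] {T : ℝ → X → X}

theorem measurable_swap (hT : IsMeasurableFlow T) : Measurable fun p : X × ℝ => T p.2 p.1 :=
  hT.measurable.comp _root_.measurable_swap

theorem measurable_apply (hT : IsMeasurableFlow T) (t : ℝ) : Measurable (T t) :=
  hT.measurable.comp measurable_prodMk_left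

theorem measurable_orbit (hT : IsMeasurableFlow T) (x : X) : Measurable fun t => T t x :=
  hT.measurable.comp measurable_prodMk_right

theorem measurable_integral (hT : IsMeasurableFlow T) {f : X → ℝ} (hf : Measurable f) (a b : ℝ) :
    Measurable fun x => ∫ s in a..b, f (T s x) := by
  have h : StronglyMeasurable fun p : X × ℝ => f (T p.2 p.1) :=
    (hf.comp hT.measurable_swap).stronglyMeasurable
  simp only [intervalIntegral]
  exact (h.integral_prod_right' (ν := volume.restrict (Set.Ioc a b))).measurable.sub
    (h.integral_prod_right' (ν := volume.restrict (Set.Ioc b a))).measurable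

theorem integral_comp_flow (hT : IsMeasurableFlow T) (f : X → ℝ) (a b t : ℝ) (x : X) :
    ∫ s in a..b, f (T s (T t x)) = ∫ s in (a + t)..(b + t), f (T s x) := by
  rw [← intervalIntegral.integral_comp_add_right (fun s => f (T s x)) t]
  simp only [hT.add_apply]

theorem orbitIntegral_add (hT : IsMeasurableFlow T) {f : X → ℝ} {x : X}
    (h : ∀ t, IntervalIntegrable (fun s => f (T s x)) volume 0 t) (s t : ℝ) :
    orbitIntegral T f (s + t) x = orbitIntegral T f s x + orbitIntegral T f t (T s x) := by
  unfold orbitIntegral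
  rw [hT.integral_comp_flow, zero_add, add_comm t s,
    intervalIntegral.integral_add_adjacent_intervals (h s) (intervalIntegrable_orbit h _ _)]

variable {μ : Measure X}

theorem ae_orbit [SFinite μ] (hT : IsMeasurableFlow T) (hp : ∀ t, MeasurePreserving (T t) μ μ)
    {p : X → Prop} (h : ∀ᵐ x ∂μ, p x) : ∀ᵐ x ∂μ, ∀ᵐ s : ℝ, p (T s x) := by
  obtain ⟨Z, hZ, hZm, hZ0⟩ := exists_measurable_superset_of_null (ae_iff.1 h)
  have key : ∀ᵐ x ∂μ, ∀ᵐ s : ℝ, T s x ∈ Zᶜ := by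
    rw [Measure.ae_ae_comm (p := fun x s => T s x ∈ Zᶜ) (hT.measurable_swap hZm.compl)]
    refine Eventually.of_forall fun s => (hp s).quasiMeasurePreserving.ae ?_
    exact compl_mem_ae_iff.2 hZ0
  filter_upwards [key] with x hx
  filter_upwards [hx] with s hs
  by_contra hn
  exact hs (hZ hn)

/-- By Fubini some single time s works for almost every x, and T_s preserves μ. This transfers
one-dimensional facts about orbits to almost every point of the space. -/
theorem ae_of_ae_orbit [SFinite μ] (hT : IsMeasurableFlow T)
    (hp : ∀ t, MeasurePreserving (T t) μ μ) {p : X → Prop} (hm : MeasurableSet {x | p x})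
    (h : ∀ᵐ x ∂μ, ∀ᵐ s : ℝ, p (T s x)) : ∀ᵐ x ∂μ, p x := by
  rw [Measure.ae_ae_comm (p := fun x s => p (T s x)) (hT.measurable_swap hm)] at h
  obtain ⟨s, hs⟩ := h.exists
  rw [← (hp s).map_eq]
  exact (ae_map_iff (hT.measurable_apply s).aemeasurable hm).2 hs

theorem ae_integral_congr [SFinite μ] (hT : IsMeasurableFlow T)
    (hp : ∀ t, MeasurePreserving (T t) μ μ) {f g : X → ℝ} (h : f =ᵐ[μ] g) :
    ∀ᵐ x ∂μ, ∀ a b : ℝ, ∫ s in a..b, f (T s x) = ∫ s in a..b, g (T s x) := by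
  filter_upwards [hT.ae_orbit hp h] with x hx a b
  exact intervalIntegral.integral_congr_ae (hx.mono fun s hs _ => hs)

/-- All time slices of (s, x) ↦ f (T_s x) have the same L¹ norm, so this function is integrable on
[-N, N] × X and Fubini applies. -/
theorem ae_intervalIntegrable [SFinite μ] (hT : IsMeasurableFlow T)
    (hp : ∀ t, MeasurePreserving (T t) μ μ) {f : X → ℝ} (hf : Integrable f μ) :
    ∀ᵐ x ∂μ, ∀ t, IntervalIntegrable (fun s => f (T s x)) volume 0 t := by
  obtain ⟨g, hg, hfg⟩ := hf.aestronglyMeasurable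
  have hgi : Integrable g μ := hf.congr hfg
  have key : ∀ N : ℕ, ∀ᵐ x ∂μ,
      Integrable (fun s => g (T s x)) (volume.restrict (Set.Icc (-N : ℝ) N)) := by
    intro N
    have : Integrable (fun p : ℝ × X => g (T p.1 p.2))
        ((volume.restrict (Set.Icc (-N : ℝ) N)).prod μ) := by
      rw [integrable_prod_iff (f := fun p : ℝ × X => g (T p.1 p.2))
        (hg.comp_measurable hT.measurable).aestronglyMeasurable]
      refine ⟨Eventually.of_forall fun s => (hp s).integrable_comp_of_integrable hgi, ?_⟩
      have : ∀ s, ∫ x, ‖g (T s x)‖ ∂μ = ∫ x, ‖g x‖ ∂μ := fun s => by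
        have := integral_map (μ := μ) (hT.measurable_apply s).aemeasurable
          (f := fun x => ‖g x‖) hg.norm.aestronglyMeasurable
        rw [(hp s).map_eq] at this
        exact this.symm
      simp only [this]
      exact integrable_const _
    exact this.prod_left_ae
  filter_upwards [ae_all_iff.2 key, hT.ae_orbit hp hfg] with x hx hx' t
  obtain ⟨N, hN⟩ := exists_nat_ge |t|
  have h1 : IntervalIntegrable (fun s => g (T s x)) volume 0 t := by
    rw [intervalIntegrable_iff]
    refine (show IntegrableOn _ (Set.Icc (-N : ℝ) N) volume from hx N).mono_set ?_
    intro s hs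
    rw [Set.mem_uIoc] at hs
    have := abs_le.1 (hN)
    constructor <;> rcases hs with hs | hs <;> linarith
  exact h1.congr_ae (ae_restrict_of_ae (hx'.mono fun s hs => hs.symm))

theorem lintegral_enorm_integral_le [SFinite μ] (hT : IsMeasurableFlow T)
    (hp : ∀ t, MeasurePreserving (T t) μ μ) {f : X → ℝ} (hf : AEStronglyMeasurable f μ) (a b : ℝ) :
    ∫⁻ x, ‖∫ s in a..b, f (T s x)‖ₑ ∂μ ≤ ENNReal.ofReal |b - a| * ∫⁻ x, ‖f x‖ₑ ∂μ := by
  obtain ⟨g, hg, hfg⟩ := hf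
  have e1 : ∫⁻ x, ‖∫ s in a..b, f (T s x)‖ₑ ∂μ = ∫⁻ x, ‖∫ s in a..b, g (T s x)‖ₑ ∂μ :=
    lintegral_congr_ae ((hT.ae_integral_congr hp hfg).mono fun x hx => by simp only [hx a b])
  have e2 : ∫⁻ x, ‖f x‖ₑ ∂μ = ∫⁻ x, ‖g x‖ₑ ∂μ :=
    lintegral_congr_ae (hfg.mono fun x hx => by simp only [hx])
  rw [e1, e2]
  calc ∫⁻ x, ‖∫ s in a..b, g (T s x)‖ₑ ∂μ
      ≤ ∫⁻ x, (∫⁻ s in Set.uIoc a b, ‖g (T s x)‖ₑ) ∂μ := by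
        refine lintegral_mono fun x => ?_
        rw [intervalIntegral.intervalIntegral_eq_integral_uIoc]
        refine le_trans (le_of_eq ?_) (enorm_integral_le_lintegral_enorm _)
        split_ifs <;> simp
    _ = ∫⁻ s in Set.uIoc a b, ∫⁻ x, ‖g (T s x)‖ₑ ∂μ :=
        lintegral_lintegral_swap
          (hg.measurable.comp hT.measurable_swap).enorm.aemeasurable
    _ = ∫⁻ s in Set.uIoc a b, ∫⁻ x, ‖g x‖ₑ ∂μ := by
        congr 1
        ext s
        exact (hp s).lintegral_comp hg.measurable.enorm
    _ = _ := by
        rw [lintegral_const, mul_comm]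
        simp [Set.uIoc, Real.volume_Ioc, max_sub_min_eq_abs]

/-- For an ergodic measurable flow, a set that is almost invariant under every `T t` is null or
conull. -/
theorem null_or_conull_of_ae_invariant [SFinite μ] (hT : IsMeasurableFlow T)
    (he : IsErgodicFlow T μ) {E : Set X} (hE : MeasurableSet E)
    (h : ∀ t, ∀ᵐ x ∂μ, (T t x ∈ E ↔ x ∈ E)) : (∀ᵐ x ∂μ, x ∈ E) ∨ ∀ᵐ x ∂μ, x ∉ E := by
  -- Ergodicity is stated for strictly invariant sets only. This set is strictly invariant, as
  -- translations preserve Lebesgue null sets, and it equals E up to a null set by Fubini.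
  set E' : Set X := {x | ∀ᵐ s : ℝ, T s x ∈ E} with hE'
  have hm : MeasurableSet E' := by
    have : Measurable fun x => volume {s : ℝ | T s x ∉ E} :=
      measurable_measure_prodMk_left (hT.measurable_swap hE.compl)
    exact this (measurableSet_singleton 0)
  have hinv : ∀ t, T t ⁻¹' E' = E' := by
    intro t
    ext x
    simp only [hE', Set.mem_preimage, Set.mem_ofPred_eq, ← hT.add_apply]
    constructor
    · intro hx
      have := (measurePreserving_sub_right (volume : Measure ℝ) t).quasiMeasurePreserving.ae hx
      simpa using this
    · intro hx
      exact (measurePreserving_add_right (volume : Measure ℝ) t).quasiMeasurePreserving.ae hx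
  have hEE : ∀ᵐ x ∂μ, (x ∈ E' ↔ x ∈ E) := by
    have : ∀ᵐ x ∂μ, ∀ᵐ s : ℝ, (T s x ∈ E ↔ x ∈ E) := by
      rw [Measure.ae_ae_comm (p := fun x s => (T s x ∈ E ↔ x ∈ E))]
      · exact Eventually.of_forall h
      · exact (hT.measurable_swap hE).iff (measurable_fst hE)
    filter_upwards [this] with x hx
    constructor
    · intro (h1 : ∀ᵐ s : ℝ, T s x ∈ E)
      obtain ⟨s, hs, hs'⟩ := (h1.and hx).exists
      exact hs'.1 hs
    · intro h1
      filter_upwards [hx] with s hs using hs.2 h1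
  rcases he.null_or_conull E' hm hinv with h0 | h0
  · right
    filter_upwards [hEE, measure_eq_zero_iff_ae_notMem.1 h0] with x h1 h2 h3
    exact h2 (h1.2 h3)
  · left
    filter_upwards [hEE, measure_eq_zero_iff_ae_notMem.1 h0] with x h1 h2
    exact h1.1 (not_not.1 h2)

end IsMeasurableFlow

/-! ### The mean ergodic theorem in L¹ -/

namespace IsMeasurableFlow

variable {X : Type*} [MeasurableSpace X] {T : ℝ → X → X} {μ : Measure X}

theorem ae_orbitIntegral_add_apply [SFinite μ] (hT : IsMeasurableFlow T)
    (hp : ∀ t, MeasurePreserving (T t) μ μ) {f g h : X → ℝ} (hf : Integrable f μ)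
    (hg : Integrable g μ) (hh : h =ᵐ[μ] fun x => f x + g x) :
    ∀ᵐ x ∂μ, ∀ t, orbitIntegral T h t x = orbitIntegral T f t x + orbitIntegral T g t x := by
  filter_upwards [hT.ae_intervalIntegrable hp hf, hT.ae_intervalIntegrable hp hg,
    hT.ae_integral_congr hp hh] with x h1 h2 h3 t
  rw [orbitIntegral, h3, intervalIntegral.integral_add (h1 t) (h2 t)]
  rfl

theorem ae_orbitIntegral_smul_apply [SFinite μ] (hT : IsMeasurableFlow T)
    (hp : ∀ t, MeasurePreserving (T t) μ μ) {f h : X → ℝ} (c : ℝ)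
    (hh : h =ᵐ[μ] fun x => c * f x) :
    ∀ᵐ x ∂μ, ∀ t, orbitIntegral T h t x = c * orbitIntegral T f t x := by
  filter_upwards [hT.ae_integral_congr hp hh] with x h3 t
  rw [orbitIntegral, h3, intervalIntegral.integral_const_mul]
  rfl

theorem aemeasurable_orbitIntegral [SFinite μ] (hT : IsMeasurableFlow T)
    (hp : ∀ t, MeasurePreserving (T t) μ μ) {f : X → ℝ} (hf : Integrable f μ) (t : ℝ) :
    AEMeasurable (orbitIntegral T f t) μ := by
  obtain ⟨g, hg, hfg⟩ := hf.aestronglyMeasurable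
  refine ⟨_, hT.measurable_integral hg.measurable 0 t, ?_⟩
  filter_upwards [hT.ae_integral_congr hp hfg] with x hx using hx 0 t

/-- The orbit integrals of a coboundary `g ∘ T t - g` are bounded in mean. -/
theorem lintegral_orbitIntegral_coboundary_le [SFinite μ] (hT : IsMeasurableFlow T)
    (hp : ∀ t, MeasurePreserving (T t) μ μ) {g h : X → ℝ} (hg : Integrable g μ) (t : ℝ)
    (hh : h =ᵐ[μ] fun x => g (T t x) - g x) (n : ℝ) :
    ∫⁻ x, ‖orbitIntegral T h n x‖ₑ ∂μ ≤ 2 * (ENNReal.ofReal |t| * ∫⁻ x, ‖g x‖ₑ ∂μ) := by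
  -- The integral telescopes: only the windows from n to n + t and from 0 to t survive, and their
  -- means are bounded independently of n.
  have h1 : ∀ᵐ x ∂μ, ‖orbitIntegral T h n x‖ₑ ≤
      ‖∫ s in n..(n + t), g (T s x)‖ₑ + ‖∫ s in (0 : ℝ)..t, g (T s x)‖ₑ := by
    filter_upwards [hT.ae_intervalIntegrable hp hg, hT.ae_integral_congr hp hh] with x hx1 hx2
    refine le_trans (le_of_eq ?_) (enorm_sub_le (E := ℝ))
    congr 1
    have h2 : IntervalIntegrable (fun s => g (T t (T s x))) volume 0 n := by
      have := (intervalIntegrable_orbit hx1 (0 + t) (n + t)).comp_add_right t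
      simp only [add_sub_cancel_right] at this
      simpa only [add_comm _ t, hT.add_apply] using this
    rw [orbitIntegral, hx2, intervalIntegral.integral_sub h2 (hx1 n)]
    have h3 : ∀ s, T t (T s x) = T s (T t x) := fun s => by
      rw [← hT.add_apply, ← hT.add_apply, add_comm]
    simp only [h3]
    rw [hT.integral_comp_flow, zero_add]
    have e1 := intervalIntegral.integral_add_adjacent_intervals (hx1 t)
      (intervalIntegrable_orbit hx1 t (n + t))
    have e2 := intervalIntegral.integral_add_adjacent_intervals (hx1 n)
      (intervalIntegrable_orbit hx1 n (n + t))
    linarith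
  calc _ ≤ ∫⁻ x, (‖∫ s in n..(n + t), g (T s x)‖ₑ + ‖∫ s in (0 : ℝ)..t, g (T s x)‖ₑ) ∂μ :=
        lintegral_mono_ae h1
    _ = ∫⁻ x, ‖∫ s in n..(n + t), g (T s x)‖ₑ ∂μ +
          ∫⁻ x, ‖∫ s in (0 : ℝ)..t, g (T s x)‖ₑ ∂μ := by
        refine lintegral_add_left' ?_ _
        obtain ⟨g', hg', hgg⟩ := hg.aestronglyMeasurable
        refine ((hT.measurable_integral hg'.measurable n (n + t)).enorm.aemeasurable).congr ?_
        filter_upwards [hT.ae_integral_congr hp hgg] with x hx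
        rw [hx]
    _ ≤ _ := by
        have h2 := hT.lintegral_enorm_integral_le hp hg.aestronglyMeasurable n (n + t)
        have h3 := hT.lintegral_enorm_integral_le hp hg.aestronglyMeasurable 0 t
        rw [add_sub_cancel_left] at h2
        rw [sub_zero] at h3
        rw [two_mul]
        exact add_le_add h2 h3

theorem ae_eq_const_of_ae_invariant [SFinite μ] (hT : IsMeasurableFlow T)
    (he : IsErgodicFlow T μ) {h : X → ℝ} (hm : AEStronglyMeasurable h μ)
    (hinv : ∀ t, (fun x => h (T t x)) =ᵐ[μ] h) : ∃ c, h =ᵐ[μ] fun _ => c := by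
  obtain ⟨g, hg, hgh⟩ := hm
  have hginv : ∀ t, ∀ᵐ x ∂μ, g (T t x) = g x := by
    intro t
    filter_upwards [hinv t, hgh, (he.measurePreserving t).quasiMeasurePreserving.ae hgh]
      with x h1 h2 h3
    rw [← h2, ← h3, h1]
  obtain ⟨c, hc⟩ := exists_eventuallyEq_const_of_eventually_mem_of_forall_separating
    (l := ae μ) (f := g) (s := Set.univ) MeasurableSet (Eventually.of_forall fun _ => trivial)
    fun U hU => hT.null_or_conull_of_ae_invariant he (hg.measurable hU) fun t => by
      filter_upwards [hginv t] with x hx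
      change g (T t x) ∈ U ↔ g x ∈ U
      rw [hx]
  exact ⟨c, hgh.trans hc⟩

/-- The span of the `L²` coboundaries of the flow. -/
noncomputable def coboundarySpan (hp : ∀ t, MeasurePreserving (T t) μ μ) :
    Submodule ℝ (Lp ℝ 2 μ) :=
  Submodule.span ℝ {u | ∃ (t : ℝ) (g : Lp ℝ 2 μ), u = Lp.compMeasurePreserving (T t) (hp t) g - g}

/-- Von Neumann's argument. If h is orthogonal to all coboundaries, testing against the coboundary
of h itself and using that h ∘ T_t has the norm of h gives ‖h ∘ T_t - h‖ = 0. So h is invariant,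
hence constant, hence orthogonal to every function of mean zero. -/
theorem mem_closure_coboundarySpan [IsFiniteMeasure μ] (hT : IsMeasurableFlow T)
    (he : IsErgodicFlow T μ) (f : Lp ℝ 2 μ) (hf : ∫ x, f x ∂μ = 0) :
    f ∈ (coboundarySpan he.measurePreserving).topologicalClosure := by
  rw [← Submodule.orthogonal_orthogonal_eq_closure, Submodule.mem_orthogonal]
  intro h hh
  rw [Submodule.mem_orthogonal] at hh
  have hinv : ∀ t, (fun x => h (T t x)) =ᵐ[μ] h := by
    intro t
    set h' := Lp.compMeasurePreserving (T t) (he.measurePreserving t) h with hh'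
    have hn : ‖h'‖ = ‖h‖ := Lp.norm_compMeasurePreserving h (he.measurePreserving t)
    have h1 : inner ℝ (h' - h) h = 0 := hh _ (Submodule.subset_span ⟨t, h, rfl⟩)
    have h2 : ‖h' - h‖ ^ 2 = 0 := by
      rw [inner_sub_left, real_inner_self_eq_norm_sq] at h1
      rw [norm_sub_sq_real, hn]
      linarith
    have h3 : h' = h := by
      rw [← sub_eq_zero, ← norm_eq_zero]
      exact pow_eq_zero_iff two_ne_zero |>.1 h2
    have h4 := Lp.coeFn_compMeasurePreserving h (he.measurePreserving t)
    rw [← hh', h3] at h4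
    exact h4.symm
  obtain ⟨c, hc⟩ := hT.ae_eq_const_of_ae_invariant he (Lp.aestronglyMeasurable h) hinv
  rw [L2.inner_def]
  have : ∫ x, inner ℝ (h x) (f x) ∂μ = ∫ x, c * f x ∂μ := by
    refine integral_congr_ae ?_
    filter_upwards [hc] with x hx
    rw [hx]
    simp [mul_comm]
  rw [this, integral_const_mul, hf, mul_zero]

theorem exists_bound_of_mem_coboundarySpan [IsFiniteMeasure μ] (hT : IsMeasurableFlow T)
    (hp : ∀ t, MeasurePreserving (T t) μ μ) {u : Lp ℝ 2 μ} (hu : u ∈ coboundarySpan hp) :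
    ∃ K : ENNReal, K ≠ ⊤ ∧ ∀ n : ℝ, ∫⁻ x, ‖orbitIntegral T u n x‖ₑ ∂μ ≤ K := by
  have hint : ∀ v : Lp ℝ 2 μ, Integrable v μ := fun v => (Lp.memLp v).integrable (by norm_num)
  induction hu using Submodule.span_induction with
  | mem v hv =>
    obtain ⟨t, g, rfl⟩ := hv
    refine ⟨_, ?_, fun n => hT.lintegral_orbitIntegral_coboundary_le hp (hint g) t ?_ n⟩
    · exact ENNReal.mul_ne_top (by simp) (ENNReal.mul_ne_top (by simp) (hint g).2.ne)
    · filter_upwards [Lp.coeFn_sub (Lp.compMeasurePreserving (T t) (hp t) g) g,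
        Lp.coeFn_compMeasurePreserving g (hp t)] with x h1 h2
      rw [h1, Pi.sub_apply, h2]
      rfl
  | zero =>
    refine ⟨0, by simp, fun n => ?_⟩
    have h1 : ⇑(0 : Lp ℝ 2 μ) =ᵐ[μ] fun _ => 0 := Lp.coeFn_zero ℝ 2 μ
    rw [lintegral_congr_ae (g := fun _ => 0)]
    · simp
    · filter_upwards [hT.ae_integral_congr hp h1] with x hx
      rw [orbitIntegral, hx]
      simp
  | add v w _ _ hv hw =>
    obtain ⟨K, hK, hK'⟩ := hv
    obtain ⟨L, hL, hL'⟩ := hw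
    refine ⟨K + L, by simp [hK, hL], fun n => ?_⟩
    refine le_trans ?_ (add_le_add (hK' n) (hL' n))
    rw [← lintegral_add_left' (hT.aemeasurable_orbitIntegral hp (hint v) n).enorm]
    refine lintegral_mono_ae ?_
    filter_upwards [hT.ae_orbitIntegral_add_apply hp (hint v) (hint w) (Lp.coeFn_add v w)]
      with x hx
    rw [hx n]
    exact enorm_add_le _ _
  | smul c v _ hv =>
    obtain ⟨K, hK, hK'⟩ := hv
    refine ⟨‖c‖ₑ * K, ENNReal.mul_ne_top (by simp) hK, fun n => ?_⟩
    calc _ = ∫⁻ x, ‖c‖ₑ * ‖orbitIntegral T v n x‖ₑ ∂μ := by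
          refine lintegral_congr_ae ?_
          filter_upwards [hT.ae_orbitIntegral_smul_apply hp c (Lp.coeFn_smul c v)] with x hx
          rw [hx, enorm_mul]
      _ = ‖c‖ₑ * ∫⁻ x, ‖orbitIntegral T v n x‖ₑ ∂μ := lintegral_const_mul' _ _ (by simp)
      _ ≤ _ := by gcongr; exact hK' n

/-- A simple function g close to f in L¹ has a small integral, because f has integral zero.
Subtracting its average c costs little and puts g - c in the L² closure of the coboundaries. -/
theorem exists_mem_coboundarySpan_lintegral_sub_le [IsFiniteMeasure μ] (hT : IsMeasurableFlow T)
    (he : IsErgodicFlow T μ) {f : X → ℝ} (hf : Integrable f μ) (hf0 : ∫ x, f x ∂μ = 0)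
    {ε : ENNReal} (hε : ε ≠ 0) :
    ∃ u ∈ coboundarySpan he.measurePreserving, ∫⁻ x, ‖f x - u x‖ₑ ∂μ ≤ ε := by
  have hε3 : ε / 3 ≠ 0 := ENNReal.div_ne_zero.2 ⟨hε, by simp⟩
  obtain ⟨g, hg, -⟩ := (memLp_one_iff_integrable.2 hf).exists_simpleFunc_eLpNorm_sub_lt
    ENNReal.one_ne_top hε3
  rw [eLpNorm_one_eq_lintegral_enorm] at hg
  have hgi : Integrable g μ := g.integrable_of_isFiniteMeasure
  have hg2 : MemLp g 2 μ := g.memLp_of_isFiniteMeasure 2 μ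
  set c := ⨍ x, g x ∂μ with hc
  have hG2 : MemLp (fun x => g x - c) 2 μ := hg2.sub (memLp_const c)
  set G := hG2.toLp with hG
  have hGae : G =ᵐ[μ] fun x => g x - c := hG2.coeFn_toLp
  have hG0 : ∫ x, G x ∂μ = 0 := by
    rw [integral_congr_ae hGae]
    exact integral_sub_average μ g
  have hcc : ∫⁻ _ : X, ‖c‖ₑ ∂μ ≤ ε / 3 := by
    have h1 : ∫⁻ _ : X, ‖c‖ₑ ∂μ = ‖∫ x, (f x - g x) ∂μ‖ₑ := by
      rw [integral_sub hf hgi, hf0, zero_sub, enorm_neg, ← measure_smul_average, enorm_smul,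
        lintegral_const, mul_comm, ← hc, measureReal_def,
        Real.enorm_eq_ofReal ENNReal.toReal_nonneg, ENNReal.ofReal_toReal (measure_ne_top _ _)]
    rw [h1]
    exact (enorm_integral_le_lintegral_enorm _).trans hg.le
  -- The factor μ(X)^(1/2) is the Hölder constant for passing from the L² norm to the L¹ norm.
  obtain ⟨δ, hδ, hδ'⟩ := ENNReal.exists_nnreal_pos_mul_lt
    (a := μ Set.univ ^ (1 / 2 : ℝ)) (by finiteness) hε3
  obtain ⟨u, hu, huG⟩ := EMetric.mem_closure_iff.1 (hT.mem_closure_coboundarySpan he G hG0) δ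
    (by exact_mod_cast hδ)
  refine ⟨u, hu, ?_⟩
  have hGu : ∫⁻ x, ‖G x - u x‖ₑ ∂μ ≤ ε / 3 := by
    rw [Lp.edist_def] at huG
    have h1 := eLpNorm_le_eLpNorm_mul_rpow_measure_univ (μ := μ) (p := 1) (q := 2)
      (f := ⇑G - ⇑u) (by norm_num)
      ((Lp.aestronglyMeasurable G).sub (Lp.aestronglyMeasurable u))
    rw [eLpNorm_one_eq_lintegral_enorm] at h1
    refine h1.trans (le_trans ?_ hδ'.le)
    norm_num
    gcongr
  have hGm : AEMeasurable (fun x => ‖G x - u x‖ₑ) μ :=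
    ((Lp.aestronglyMeasurable G).sub (Lp.aestronglyMeasurable u)).enorm
  calc ∫⁻ x, ‖f x - u x‖ₑ ∂μ
      ≤ ∫⁻ x, (‖f x - g x‖ₑ + ‖c‖ₑ + ‖G x - u x‖ₑ) ∂μ := by
        refine lintegral_mono_ae ?_
        filter_upwards [hGae] with x hx
        have h1 : f x - u x = (f x - g x) + c + (G x - u x) := by
          rw [hx]
          ring
        rw [h1]
        refine (enorm_add_le _ _).trans ?_
        gcongr
        exact enorm_add_le _ _
    _ = ∫⁻ x, ‖f x - g x‖ₑ ∂μ + ∫⁻ _ : X, ‖c‖ₑ ∂μ + ∫⁻ x, ‖G x - u x‖ₑ ∂μ := by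
        rw [lintegral_add_right' _ hGm, lintegral_add_right _ measurable_const]
    _ ≤ ε / 3 + ε / 3 + ε / 3 := by
        gcongr
        exact hg.le
    _ = ε := ENNReal.add_thirds ε

/-- The mean ergodic theorem in `L¹`. -/
theorem lintegral_orbitIntegral_le [IsFiniteMeasure μ] (hT : IsMeasurableFlow T)
    (he : IsErgodicFlow T μ) {f : X → ℝ} (hf : Integrable f μ) (hf0 : ∫ x, f x ∂μ = 0)
    {ε : ℝ} (hε : 0 < ε) : ∃ K : ℝ, 0 ≤ K ∧ ∀ t : ℝ, 0 ≤ t →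
      ∫⁻ x, ‖orbitIntegral T f t x‖ₑ ∂μ ≤ ENNReal.ofReal (ε * t + K) := by
  have hp := he.measurePreserving
  obtain ⟨u, hu, hfu⟩ := hT.exists_mem_coboundarySpan_lintegral_sub_le he hf hf0
    (ENNReal.ofReal_pos.2 hε).ne'
  obtain ⟨K, hK, hK'⟩ := hT.exists_bound_of_mem_coboundarySpan hp hu
  have hui : Integrable u μ := (Lp.memLp u).integrable (by norm_num)
  have hd : Integrable (fun x => f x - u x) μ := hf.sub hui
  refine ⟨K.toReal, ENNReal.toReal_nonneg, fun t ht => ?_⟩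
  rw [ENNReal.ofReal_add (by positivity) ENNReal.toReal_nonneg, ENNReal.ofReal_toReal hK]
  calc _ ≤ ∫⁻ x, (‖orbitIntegral T (fun x => f x - u x) t x‖ₑ + ‖orbitIntegral T u t x‖ₑ) ∂μ := by
        refine lintegral_mono_ae ?_
        filter_upwards [hT.ae_orbitIntegral_add_apply hp hd hui (h := f)
          (Eventually.of_forall fun x => by simp)] with x hx
        rw [hx t]
        exact enorm_add_le _ _
    _ = ∫⁻ x, ‖orbitIntegral T (fun x => f x - u x) t x‖ₑ ∂μ +
        ∫⁻ x, ‖orbitIntegral T u t x‖ₑ ∂μ :=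
        lintegral_add_left' (hT.aemeasurable_orbitIntegral hp hd t).enorm _
    _ ≤ _ := by
        refine add_le_add ?_ (hK' t)
        refine (hT.lintegral_enorm_integral_le hp hd.aestronglyMeasurable 0 t).trans ?_
        rw [sub_zero, abs_of_nonneg ht, mul_comm ε, ENNReal.ofReal_mul ht]
        gcongr

end IsMeasurableFlow

/-! ### Recurrence of cocycles of sublinear mean -/

/-- Separated values fall into different cells of length η, so k ↦ ⌊v k / η⌋ is injective on K. -/
theorem card_le_of_separated {K : Finset ℕ} {v : ℕ → ℝ} {η R : ℝ} (hη : 0 < η) (hR : 0 ≤ R)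
    (hv : ∀ k ∈ K, |v k| ≤ R) (hs : ∀ j ∈ K, ∀ k ∈ K, j < k → η ≤ |v k - v j|) :
    (K.card : ℝ) ≤ 2 * R / η + 2 := by
  have hinj : Set.InjOn (fun k => ⌊v k / η⌋) K := by
    have aux : ∀ j ∈ K, ∀ k ∈ K, ⌊v j / η⌋ = ⌊v k / η⌋ → ¬ j < k := by
      intro j hj k hk h hlt
      have h1 := Int.abs_sub_lt_one_of_floor_eq_floor h.symm
      rw [← sub_div, abs_div, abs_of_pos hη, div_lt_one hη] at h1
      exact absurd (hs j hj k hk hlt) (not_le.2 h1)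
    intro j hj k hk h
    exact le_antisymm (not_lt.1 (aux k hk j hj h.symm)) (not_lt.1 (aux j hj k hk h))
  have hmaps : ∀ k ∈ K, ⌊v k / η⌋ ∈ Finset.Icc ⌊-R / η⌋ ⌊R / η⌋ := by
    intro k hk
    have := abs_le.1 (hv k hk)
    rw [Finset.mem_Icc]
    constructor <;> gcongr <;> linarith
  have hcard := Finset.card_le_card_of_injOn _ hmaps hinj
  rw [Int.card_Icc] at hcard
  have h0 : ⌊-R / η⌋ ≤ ⌊R / η⌋ := by
    gcongr
    linarith
  have h1 : (K.card : ℤ) ≤ ⌊R / η⌋ + 1 - ⌊-R / η⌋ := by omega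
  have h2 : (K.card : ℝ) ≤ ⌊R / η⌋ + 1 - ⌊-R / η⌋ := by exact_mod_cast h1
  have h3 := Int.floor_le (R / η)
  have h4 := Int.lt_floor_add_one (-R / η)
  have h5 : -R / η = -(R / η) := neg_div _ _
  have h6 : 2 * R / η = 2 * (R / η) := mul_div_assoc _ _ _
  rw [h5] at h2 h4
  rw [h6]
  linarith

/-- If the values of a cocycle of sublinear mean along the visits of every orbit to `C` are
separated, then `C` is null. -/
theorem measure_eq_zero_of_separated_cocycle {X : Type*} [MeasurableSpace X] {μ : Measure X}
    [IsFiniteMeasure μ] {S : X → X} (hS : MeasurePreserving S μ μ) {φ : ℕ → X → ℝ}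
    (hφ : ∀ n, Measurable (φ n)) (hadd : ∀ j k x, φ (j + k) x = φ j x + φ k (S^[j] x))
    (hmean : ∀ ε : ℝ, 0 < ε → ∃ K : ℝ, 0 ≤ K ∧
      ∀ n : ℕ, ∫⁻ x, ‖φ n x‖ₑ ∂μ ≤ ENNReal.ofReal (ε * n + K))
    {C : Set X} (hC : MeasurableSet C) {η : ℝ} (hη : 0 < η)
    (hsep : ∀ x ∈ C, ∀ k, 1 ≤ k → S^[k] x ∈ C → η ≤ |φ k x|) : μ C = 0 := by
  set M := μ.real Set.univ with hM
  have hM0 : 0 ≤ M := measureReal_nonneg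
  -- Double counting of the visits to C before time n: since S preserves μ, their mean number is n
  -- μ(C). Visits with |φ| ≤ δ n are few by separation, those with |φ| ≥ δ n by Markov's inequality.
  have bound : ∀ δ : ℝ, 0 < δ → ∃ K : ℝ, ∀ n : ℕ, 0 < n →
      μ.real C ≤ (2 * δ / η * M + δ) + (2 * M + K / δ) / n := by
    intro δ hδ
    -- With rate δ², Markov's inequality at height δ n leaves measure at most δ + K / (δ n).
    obtain ⟨K, hK0, hK⟩ := hmean (δ ^ 2) (by positivity)
    refine ⟨K, fun n hn => ?_⟩
    have hn' : (0 : ℝ) < n := by exact_mod_cast hn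
    have hmA : ∀ k, MeasurableSet (S^[k] ⁻¹' C ∩ {x | |φ k x| ≤ δ * n}) := fun k =>
      ((hS.measurable.iterate k) hC).inter (measurableSet_le (hφ k).norm measurable_const)
    have hbig : ∀ k ∈ Finset.range n, μ.real {x | δ * n ≤ |φ k x|} ≤ δ + K / δ / n := by
      intro k hk
      have h1 := mul_meas_ge_le_lintegral (μ := μ) (hφ k).enorm (ENNReal.ofReal (δ * n))
      have h2 : {x | ENNReal.ofReal (δ * n) ≤ ‖φ k x‖ₑ} = {x | δ * n ≤ |φ k x|} := by
        ext x
        simp only [Set.mem_ofPred_eq, ← ofReal_norm, Real.norm_eq_abs]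
        exact ENNReal.ofReal_le_ofReal_iff (abs_nonneg _)
      rw [h2] at h1
      have h3 := h1.trans (hK k)
      rw [← ENNReal.ofReal_toReal (measure_ne_top μ {x | δ * n ≤ |φ k x|}),
        ← ENNReal.ofReal_mul (by positivity),
        ENNReal.ofReal_le_ofReal_iff (by positivity)] at h3
      have hkn : (k : ℝ) ≤ n := by exact_mod_cast (Finset.mem_range.1 hk).le
      have h4 : δ * n * μ.real {x | δ * n ≤ |φ k x|} ≤ δ ^ 2 * n + K :=
        h3.trans (by gcongr)
      have h5 : δ + K / δ / n = (δ ^ 2 * n + K) / (δ * n) := by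
        field_simp
      rw [h5, le_div_iff₀ (by positivity)]
      linarith
    have hsmall : ∑ k ∈ Finset.range n, μ.real (S^[k] ⁻¹' C ∩ {x | |φ k x| ≤ δ * n}) ≤
        (2 * (δ * n) / η + 2) * M := by
      have h1 : ∀ k, μ.real (S^[k] ⁻¹' C ∩ {x | |φ k x| ≤ δ * n}) =
          ∫ x, (S^[k] ⁻¹' C ∩ {x | |φ k x| ≤ δ * n}).indicator (fun _ => (1 : ℝ)) x ∂μ := by
        intro k
        rw [integral_indicator_const _ (hmA k), smul_eq_mul, mul_one]
      simp only [h1]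
      rw [← integral_finsetSum _ fun k _ => (integrable_const (1 : ℝ)).indicator (hmA k)]
      have h2 : (2 * (δ * n) / η + 2) * M = ∫ _ : X, (2 * (δ * n) / η + 2) ∂μ := by
        rw [integral_const, smul_eq_mul, mul_comm]
      rw [h2]
      refine integral_mono (integrable_finsetSum _ fun k _ =>
        (integrable_const (1 : ℝ)).indicator (hmA k)) (integrable_const _) fun x => ?_
      classical
      have h3 : ∑ k ∈ Finset.range n,
          (S^[k] ⁻¹' C ∩ {x | |φ k x| ≤ δ * n}).indicator (fun _ => (1 : ℝ)) x =
          ((Finset.range n).filter fun k => S^[k] x ∈ C ∧ |φ k x| ≤ δ * n).card := by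
        rw [Finset.card_filter]
        push_cast
        refine Finset.sum_congr rfl fun k _ => ?_
        simp [Set.indicator_apply]
      simp only
      rw [h3]
      refine card_le_of_separated (v := fun k => φ k x) hη (by positivity) ?_ ?_
      · intro k hk
        exact (Finset.mem_filter.1 hk).2.2
      · intro j hj k hk hjk
        have hj' := (Finset.mem_filter.1 hj).2.1
        have hk' := (Finset.mem_filter.1 hk).2.1
        -- By the cocycle identity the difference of the values at two visits is the value of φ over
        -- the i + 1 steps between them, started at a point of C.
        obtain ⟨i, rfl⟩ := Nat.exists_eq_add_of_lt hjk
        rw [add_assoc, hadd]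
        rw [add_assoc, add_comm j, Function.iterate_add_apply] at hk'
        have := hsep _ hj' (i + 1) (by omega) hk'
        simpa using this
    have hsum : n * μ.real C ≤ (2 * (δ * n) / η + 2) * M + n * (δ + K / δ / n) := by
      have h1 : ∀ k ∈ Finset.range n, μ.real C ≤
          μ.real (S^[k] ⁻¹' C ∩ {x | |φ k x| ≤ δ * n}) + (δ + K / δ / n) := by
        intro k hk
        have h2 : μ.real C = μ.real (S^[k] ⁻¹' C) := by
          simp only [measureReal_def, (hS.iterate k).measure_preimage hC.nullMeasurableSet]
        rw [h2]
        have h3 : S^[k] ⁻¹' C ⊆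
            (S^[k] ⁻¹' C ∩ {x | |φ k x| ≤ δ * n}) ∪ {x | δ * n ≤ |φ k x|} := by
          intro x hx
          rcases le_total |φ k x| (δ * n) with h | h
          · exact Or.inl ⟨hx, h⟩
          · exact Or.inr h
        refine (measureReal_mono h3).trans ((measureReal_union_le _ _).trans ?_)
        gcongr
        exact hbig k hk
      have h4 := Finset.sum_le_sum h1
      rw [Finset.sum_add_distrib, Finset.sum_const, Finset.sum_const, Finset.card_range,
        nsmul_eq_mul, nsmul_eq_mul] at h4
      linarith
    have h7 : (2 * δ / η * M + δ) + (2 * M + K / δ) / n =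
        ((2 * (δ * n) / η + 2) * M + n * (δ + K / δ / n)) / n := by
      field_simp
      ring
    rw [h7, le_div_iff₀ hn', mul_comm]
    exact hsum
  -- K depends on δ, so n → ∞ is taken first and δ → 0 afterwards.
  have bound' : ∀ δ : ℝ, 0 < δ → μ.real C ≤ δ * (2 / η * M + 1) := by
    intro δ hδ
    obtain ⟨K, hK⟩ := bound δ hδ
    have hlim : Tendsto (fun n : ℕ => (2 * δ / η * M + δ) + (2 * M + K / δ) / n) atTop
        (𝓝 ((2 * δ / η * M + δ) + 0)) :=
      tendsto_const_nhds.add (tendsto_const_div_atTop_nhds_zero_nat _)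
    have := ge_of_tendsto hlim ((eventually_gt_atTop 0).mono hK)
    calc _ ≤ _ := this
      _ = _ := by ring
  have h0 : μ.real C ≤ 0 := by
    have hlim : Tendsto (fun δ : ℝ => δ * (2 / η * M + 1)) (𝓝[>] 0) (𝓝 (0 * (2 / η * M + 1))) :=
      (tendsto_id.mul_const _).mono_left nhdsWithin_le_nhds
    rw [zero_mul] at hlim
    exact ge_of_tendsto hlim (eventually_nhdsWithin_of_forall fun δ hδ => bound' δ hδ)
  exact (measureReal_eq_zero_iff).1 (le_antisymm h0 measureReal_nonneg)

/-! ### From small integrals at integer times to exact zeros -/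

theorem HasDerivAt.eventually_pos_and_neg {F : ℝ → ℝ} {a c : ℝ} (h : HasDerivAt F c a)
    (hc : 0 < c) (ha : F a = 0) :
    ∀ᶠ m : ℕ in atTop, 0 < F (1 / ((m : ℝ) + 1) + a) ∧ F (-(1 / ((m : ℝ) + 1)) + a) < 0 := by
  have h0 : Tendsto (fun m : ℕ => 1 / ((m : ℝ) + 1)) atTop (𝓝 0) :=
    tendsto_one_div_add_atTop_nhds_zero_nat
  have hs := (hasDerivAt_iff_tendsto_slope.1 h).eventually (lt_mem_nhds hc)
  have h1 : Tendsto (fun m : ℕ => 1 / ((m : ℝ) + 1) + a) atTop (𝓝[≠] a) := by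
    refine tendsto_nhdsWithin_iff.2 ⟨by simpa using h0.add_const a, Eventually.of_forall fun m => ?_⟩
    have : (0 : ℝ) < 1 / ((m : ℝ) + 1) := by positivity
    exact (by linarith : a < 1 / ((m : ℝ) + 1) + a).ne'
  have h2 : Tendsto (fun m : ℕ => -(1 / ((m : ℝ) + 1)) + a) atTop (𝓝[≠] a) := by
    refine tendsto_nhdsWithin_iff.2
      ⟨by simpa using h0.neg.add_const a, Eventually.of_forall fun m => ?_⟩
    have : (0 : ℝ) < 1 / ((m : ℝ) + 1) := by positivity
    exact (by linarith : -(1 / ((m : ℝ) + 1)) + a < a).ne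
  filter_upwards [h1.eventually hs, h2.eventually hs] with m hm1 hm2
  have hm : (0 : ℝ) < 1 / ((m : ℝ) + 1) := by positivity
  rw [slope_def_field, ha, sub_zero, add_sub_cancel_right] at hm1 hm2
  exact ⟨(div_pos_iff_of_pos_right hm).1 hm1, by
    by_contra hn
    exact absurd hm2 (not_lt.2 (div_nonpos_of_nonneg_of_nonpos (not_lt.1 hn) (by linarith)))⟩

namespace IsMeasurableFlow

variable {X : Type*} [MeasurableSpace X] {T : ℝ → X → X} {μ : Measure X}

theorem iterate_apply (hT : IsMeasurableFlow T) (t : ℝ) (k : ℕ) (x : X) :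
    (T t)^[k] x = T (k * t) x := by
  induction k with
  | zero => simp [hT.zero_apply]
  | succ k ih =>
    rw [Function.iterate_succ_apply', ih, ← hT.add_apply]
    push_cast
    ring_nf

/-- Sampling the flow with step N + 1 makes every later sample a time ≥ N, so the values along
visits to this set are η-separated. The sampled map T_{N+1} need not be ergodic: only its invariance
of μ and the mean growth for the whole flow enter. -/
theorem measure_no_return_eq_zero [IsFiniteMeasure μ] (hT : IsMeasurableFlow T)
    (he : IsErgodicFlow T μ) {f : X → ℝ} (hm : Measurable f) (hf : Integrable f μ)
    (hf0 : ∫ x, f x ∂μ = 0)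
    (hloc : ∀ x t, IntervalIntegrable (fun s => f (T s x)) volume 0 t)
    {B : Set X} (hB : MeasurableSet B) {η : ℝ} (hη : 0 < η) (N : ℕ) :
    μ {x | x ∈ B ∧ ∀ n : ℕ, N ≤ n → T n x ∈ B → η ≤ |orbitIntegral T f n x|} = 0 := by
  have hσ : ∀ t, Measurable (orbitIntegral T f t) := hT.measurable_integral hm 0
  set C := {x | x ∈ B ∧ ∀ n : ℕ, N ≤ n → T n x ∈ B → η ≤ |orbitIntegral T f n x|} with hC
  have hCm : MeasurableSet C := by
    have h : MeasurableSet
        {x | ∀ n : ℕ, N ≤ n → T n x ∈ B → η ≤ |orbitIntegral T f n x|} := by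
      simp only [Set.ofPred_forall]
      refine MeasurableSet.iInter fun n => MeasurableSet.iInter fun _ => ?_
      exact ((hT.measurable_apply n hB).imp (measurableSet_le measurable_const (hσ n).norm) :)
    exact hB.inter h
  refine measure_eq_zero_of_separated_cocycle (he.measurePreserving (N + 1 : ℕ))
    (φ := fun k => orbitIntegral T f (k * (N + 1 : ℕ))) (fun k => hσ _) ?_ ?_ hCm hη ?_
  · intro j k x
    rw [hT.iterate_apply, ← hT.orbitIntegral_add (hloc x)]
    push_cast
    ring_nf
  · intro ε hε
    obtain ⟨K, hK0, hK⟩ := hT.lintegral_orbitIntegral_le he hf hf0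
      (ε := ε / (N + 1 : ℕ)) (by positivity)
    refine ⟨K, hK0, fun n => (hK _ (by positivity)).trans (le_of_eq ?_)⟩
    congr 2
    field_simp
  · intro x hx k hk hk'
    rw [hT.iterate_apply] at hk'
    have e : (k : ℝ) * (N + 1 : ℕ) = (k * (N + 1) : ℕ) := by push_cast; ring
    rw [e] at hk'
    simp only [e]
    refine hx.2 _ ?_ hk'.1
    nlinarith

/-- Control at rational times keeps the sets measurable, and right continuity extends it to real
times at the cost of a closure: an orbit outside the closure at time u stays outside just after u,
where there is a rational time. -/
theorem apply_mem_closure [TopologicalSpace X] (hT : IsMeasurableFlow T)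
    (hright : ∀ x, ContinuousWithinAt (fun t => T t x) (Set.Ioi 0) 0) {U : Set X} {δ : ℝ} {y : X}
    (hU : ∀ q : ℚ, |(q : ℝ)| ≤ δ → T q y ∈ U) {u : ℝ} (hu : u ∈ Set.Ioo (-δ) δ) :
    T u y ∈ closure U := by
  by_contra hn
  have h1 : ∀ᶠ s in 𝓝[>] (0 : ℝ), T s (T u y) ∈ (closure U)ᶜ := by
    refine (hright (T u y)).eventually (isClosed_closure.isOpen_compl.mem_nhds ?_)
    change T 0 (T u y) ∉ closure U
    rwa [hT.zero_apply]
  obtain ⟨ε, hε, hε'⟩ := mem_nhdsGT_iff_exists_Ioo_subset.1 h1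
  obtain ⟨q, hq1, hq2⟩ := exists_rat_btwn
    (show u < min (u + ε) δ from lt_min (by linarith [Set.mem_Ioi.1 hε]) hu.2)
  rw [lt_min_iff] at hq2
  have h2 : T ((q : ℝ) - u) (T u y) ∈ (closure U)ᶜ :=
    hε' ⟨by linarith, by linarith⟩
  rw [← hT.add_apply, sub_add_cancel] at h2
  exact h2 (subset_closure (hU q (abs_le.2 ⟨by linarith [hu.1], hq2.2.le⟩)))

/-- Lebesgue differentiation gives this at almost every time of every orbit, and `ae_of_ae_orbit`
passes to almost every point. The discrete scales 1 / (m + 1) keep the exceptional set measurable.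
-/
theorem ae_eventually_pos_and_neg [SFinite μ] (hT : IsMeasurableFlow T)
    (hp : ∀ t, MeasurePreserving (T t) μ μ) {f : X → ℝ} (hm : Measurable f)
    (hloc : ∀ x t, IntervalIntegrable (fun s => f (T s x)) volume 0 t) :
    ∀ᵐ x ∂μ, 0 < f x → ∀ᶠ m : ℕ in atTop, 0 < orbitIntegral T f (1 / ((m : ℝ) + 1)) x ∧
      orbitIntegral T f (-(1 / ((m : ℝ) + 1))) x < 0 := by
  have hσ : ∀ t, Measurable (orbitIntegral T f t) := hT.measurable_integral hm 0
  refine hT.ae_of_ae_orbit hp ?_ (Eventually.of_forall fun x => ?_)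
  · refine (measurableSet_lt measurable_const hm).imp ?_
    simp only [eventually_atTop, Set.ofPred_exists, Set.ofPred_forall]
    refine MeasurableSet.iUnion fun i => MeasurableSet.iInter fun m => MeasurableSet.iInter fun _ => ?_
    exact (measurableSet_lt measurable_const (hσ _)).inter
      (measurableSet_lt (hσ _) measurable_const)
  · have hli : LocallyIntegrable (fun s => f (T s x)) volume := by
      rw [locallyIntegrable_iff]
      intro k hk
      obtain ⟨R, hR⟩ := hk.isBounded.subset_closedBall 0
      have := intervalIntegrable_orbit (hloc x) (-|R|) |R|
      rw [intervalIntegrable_iff_integrableOn_Icc_of_le (by linarith [abs_nonneg R])] at this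
      refine this.mono_set (hR.trans ?_)
      rw [Real.closedBall_eq_Icc]
      exact Set.Icc_subset_Icc (by linarith [le_abs_self R]) (by linarith [le_abs_self R])
    filter_upwards [LocallyIntegrable.ae_hasDerivAt_integral hli] with s hs hpos
    have h1 := (hs s).eventually_pos_and_neg hpos (by simp)
    simpa only [orbitIntegral, hT.integral_comp_flow, zero_add] using h1

theorem ae_returnsWithZeroIntegral_of_pos [TopologicalSpace X] [RegularSpace X]
    [SecondCountableTopology X] [OpensMeasurableSpace X] [IsFiniteMeasure μ]
    (hT : IsMeasurableFlow T) (he : IsErgodicFlow T μ)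
    (hright : ∀ x, ContinuousWithinAt (fun t => T t x) (Set.Ioi 0) 0)
    (hcont : ∀ᵐ x ∂μ, ContinuousAt (fun t => T t x) 0)
    {f : X → ℝ} (hm : Measurable f) (hf : Integrable f μ) (hf0 : ∫ x, f x ∂μ = 0)
    (hloc : ∀ x t, IntervalIntegrable (fun s => f (T s x)) volume 0 t) :
    ∀ᵐ x ∂μ, 0 < f x → ReturnsWithZeroIntegral T f x := by
  have hσ : ∀ t, Measurable (orbitIntegral T f t) := hT.measurable_integral hm 0
  set 𝒰 := TopologicalSpace.countableBasis X with h𝒰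
  have h𝒰c : 𝒰.Countable := TopologicalSpace.countable_countableBasis X
  have : Countable 𝒰 := h𝒰c.to_subtype
  -- The margin 1 / (k + 1) will be the tolerance for the integral up to the return time. Countably
  -- many such sets suffice, so one null set serves them all.
  let B : 𝒰 → ℕ → ℕ → Set X := fun U m k =>
    {y | (1 / ((k : ℝ) + 1) < orbitIntegral T f (1 / ((m : ℝ) + 1)) y ∧
      orbitIntegral T f (-(1 / ((m : ℝ) + 1))) y < -(1 / ((k : ℝ) + 1))) ∧
      ∀ q : ℚ, |(q : ℝ)| ≤ 1 / ((m : ℝ) + 1) → T q y ∈ (U : Set X)}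
  have hB : ∀ U m k, MeasurableSet (B U m k) := by
    intro U m k
    have h : MeasurableSet
        {y | ∀ q : ℚ, |(q : ℝ)| ≤ 1 / ((m : ℝ) + 1) → T q y ∈ (U : Set X)} := by
      simp only [Set.ofPred_forall]
      refine MeasurableSet.iInter fun q => MeasurableSet.iInter fun _ => ?_
      exact hT.measurable_apply q
        (TopologicalSpace.isOpen_of_mem_countableBasis U.2).measurableSet
    exact ((measurableSet_lt measurable_const (hσ _)).inter
      (measurableSet_lt (hσ _) measurable_const)).inter h
  have hret : ∀ᵐ x ∂μ, ∀ (U : 𝒰) (m k N : ℕ), x ∈ B U m k →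
      ∃ n : ℕ, N ≤ n ∧ T n x ∈ B U m k ∧ |orbitIntegral T f n x| < 1 / ((k : ℝ) + 1) := by
    simp only [ae_all_iff]
    intro U m k N
    have h0 := hT.measure_no_return_eq_zero he hm hf hf0 hloc (hB U m k)
      (η := 1 / ((k : ℝ) + 1)) (by positivity) N
    filter_upwards [measure_eq_zero_iff_ae_notMem.1 h0] with x hx hxB
    by_contra! hn
    exact hx ⟨hxB, hn⟩
  filter_upwards [hret, hcont, hT.ae_eventually_pos_and_neg he.measurePreserving hm hloc]
    with x hxr hxc hxs hpos
  have key : ∀ W ∈ 𝓝 x, ∀ R : ℝ, ∃ t, R ≤ t ∧ T t x ∈ W ∧ orbitIntegral T f t x = 0 := by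
    intro W hW R
    -- A closed neighbourhood is needed because the orbit at real times is only known to lie in the
    -- closure of U.
    obtain ⟨V, hV, hVc, hVW⟩ := exists_mem_nhds_isClosed_subset hW
    obtain ⟨U, hU, hxU, hUV⟩ := (TopologicalSpace.isBasis_countableBasis X).mem_nhds_iff.1 hV
    have hnear : ∀ᶠ s in 𝓝 (0 : ℝ), T s x ∈ U := by
      refine hxc.eventually ((TopologicalSpace.isOpen_of_mem_countableBasis hU).mem_nhds ?_)
      change T 0 x ∈ U
      rwa [hT.zero_apply]
    obtain ⟨r, hr, hrU⟩ := Metric.eventually_nhds_iff.1 hnear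
    have h0 : Tendsto (fun m : ℕ => 1 / ((m : ℝ) + 1)) atTop (𝓝 0) :=
      tendsto_one_div_add_atTop_nhds_zero_nat
    obtain ⟨m, ⟨hm1, hm2⟩, hmr⟩ := ((hxs hpos).and (h0.eventually (gt_mem_nhds hr))).exists
    obtain ⟨k, hk1, hk2⟩ := ((h0.eventually (gt_mem_nhds hm1)).and
      (h0.eventually (gt_mem_nhds (neg_pos.2 hm2)))).exists
    have hxB : x ∈ B ⟨U, hU⟩ m k := ⟨⟨hk1, by linarith⟩, fun q hq => hrU (by
      rw [Real.dist_0_eq_abs]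
      exact hq.trans_lt hmr)⟩
    -- The zero lies at n + u with u > -δ ≥ -1, hence the extra 1.
    obtain ⟨N, hN⟩ := exists_nat_ge (R + 1)
    obtain ⟨n, hn, ⟨⟨hy1, hy2⟩, hy3⟩, hnk⟩ := hxr ⟨U, hU⟩ m k N hxB
    rw [abs_lt] at hnk
    set δ := 1 / ((m : ℝ) + 1) with hδ
    have hδ0 : 0 < δ := by positivity
    have hδ1 : δ ≤ 1 := by
      rw [hδ, div_le_one (by positivity)]
      linarith [Nat.cast_nonneg (α := ℝ) m]
    have hcontσ : Continuous fun u => orbitIntegral T f n x + orbitIntegral T f u (T n x) :=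
      continuous_const.add
        (intervalIntegral.continuous_primitive (intervalIntegrable_orbit (hloc (T n x))) 0)
    -- At u = ±δ the increment exceeds the margin 1 / (k + 1) > |σ(n, x)| in absolute value, with
    -- opposite signs.
    obtain ⟨u, hu, hu0⟩ := intermediate_value_Ioo (by linarith : -δ ≤ δ) hcontσ.continuousOn
      (show (0 : ℝ) ∈ Set.Ioo _ _ from ⟨by linarith, by linarith⟩)
    simp only at hu0
    have hNn : (N : ℝ) ≤ n := by exact_mod_cast hn
    refine ⟨n + u, by linarith [hu.1], hVW ?_, ?_⟩
    · have h3 := hT.apply_mem_closure hright hy3 hu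
      rw [← hT.add_apply, add_comm] at h3
      exact closure_minimal hUV hVc h3
    · rw [hT.orbitIntegral_add (hloc x), hu0]
  -- All three requirements on the times are packed into one countably generated filter. A sequence
  -- along it has zero integrals only eventually, whence the later shift by K.
  set F : Filter ℝ := atTop ⊓ comap (fun t => T t x) (𝓝 x) ⊓ 𝓟 {t | orbitIntegral T f t x = 0}
    with hF
  have hne : F.NeBot := by
    rw [hF, inf_principal_neBot_iff]
    intro s hs
    rw [mem_inf_iff_superset] at hs
    obtain ⟨s₁, hs₁, s₂, hs₂, hss⟩ := hs
    obtain ⟨R, hR⟩ := mem_atTop_sets.1 hs₁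
    obtain ⟨W, hW, hWs⟩ := hs₂
    obtain ⟨t, ht1, ht2, ht3⟩ := key W hW R
    exact ⟨t, hss ⟨hR t ht1, hWs ht2⟩, ht3⟩
  obtain ⟨t, ht⟩ := exists_seq_tendsto F
  rw [hF, tendsto_inf, tendsto_inf, tendsto_principal, tendsto_comap_iff] at ht
  obtain ⟨⟨ht1, ht2⟩, ht3⟩ := ht
  obtain ⟨K, hK⟩ := eventually_atTop.1 ht3
  refine ⟨fun k => t (k + K), ht1.comp (tendsto_add_atTop_nat K), fun k => hK _ (by omega),
    ht2.comp (tendsto_add_atTop_nat K)⟩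

/-- Almost every point of an ergodic measurable flow with regular orbits at which `f` does not
vanish returns to itself with zero integrals of `f`. -/
theorem ae_returnsWithZeroIntegral [TopologicalSpace X] [RegularSpace X]
    [SecondCountableTopology X] [OpensMeasurableSpace X] [IsFiniteMeasure μ]
    (hT : IsMeasurableFlow T) (he : IsErgodicFlow T μ)
    (hright : ∀ x, ContinuousWithinAt (fun t => T t x) (Set.Ioi 0) 0)
    (hcont : ∀ᵐ x ∂μ, ContinuousAt (fun t => T t x) 0)
    {f : X → ℝ} (hf : Integrable f μ) (hf0 : ∫ x, f x ∂μ = 0) :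
    ∀ᵐ x ∂μ, (∀ t, IntervalIntegrable (fun s => f (T s x)) volume 0 t) ∧
      (f x ≠ 0 → ReturnsWithZeroIntegral T f x) := by
  have hp := he.measurePreserving
  obtain ⟨g, hg, hfg⟩ := hf.aestronglyMeasurable
  have hgm := hg.measurable
  -- This set is invariant and conull. Cutting g off outside it makes the orbit integrals exist at
  -- every point, so that the cocycle identity holds everywhere.
  set Y : Set X := {x | ∀ t, IntervalIntegrable (fun s => g (T s x)) volume 0 t} with hY
  have hYm : MeasurableSet Y := by
    have : Y = {x | ∀ N : ℕ, ∫⁻ s in Set.Icc (-N : ℝ) N, ‖g (T s x)‖ₑ < ⊤} := by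
      ext x
      have hsm : ∀ ν : Measure ℝ, AEStronglyMeasurable (fun s => g (T s x)) ν := fun ν =>
        (hg.comp_measurable (hT.measurable_orbit x)).aestronglyMeasurable
      constructor
      · intro h N
        have := intervalIntegrable_orbit h (-N) N
        rw [intervalIntegrable_iff_integrableOn_Icc_of_le
          (by linarith [Nat.cast_nonneg (α := ℝ) N])] at this
        exact this.2
      · intro h t
        obtain ⟨N, hN⟩ := exists_nat_ge |t|
        rw [intervalIntegrable_iff]
        refine (show IntegrableOn _ (Set.Icc (-N : ℝ) N) volume from ⟨hsm _, h N⟩).mono_set ?_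
        intro s hs
        rw [Set.mem_uIoc] at hs
        have := abs_le.1 hN
        constructor <;> rcases hs with hs | hs <;> linarith
    rw [this]
    simp only [Set.ofPred_forall]
    exact MeasurableSet.iInter fun N => measurableSet_lt
      ((hgm.comp hT.measurable_swap).enorm.lintegral_prod_right'
        (ν := volume.restrict (Set.Icc (-N : ℝ) N))) measurable_const
  have hYinv : ∀ x ∈ Y, ∀ t, T t x ∈ Y := by
    intro x hx t u
    have := (intervalIntegrable_orbit hx (0 + t) (u + t)).comp_add_right t
    simp only [add_sub_cancel_right] at this
    simpa only [hT.add_apply] using this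
  have hYae : ∀ᵐ x ∂μ, x ∈ Y := hT.ae_intervalIntegrable hp (hf.congr hfg)
  set g' : X → ℝ := Y.indicator g with hg'
  have hg'm : Measurable g' := hgm.indicator hYm
  have hfg' : f =ᵐ[μ] g' := by
    filter_upwards [hfg, hYae] with x h1 h2
    rw [h1, hg', Set.indicator_of_mem h2]
  have hloc : ∀ x t, IntervalIntegrable (fun s => g' (T s x)) volume 0 t := by
    intro x t
    by_cases hx : x ∈ Y
    · have : (fun s => g' (T s x)) = fun s => g (T s x) := by
        ext s
        rw [hg', Set.indicator_of_mem (hYinv x hx s)]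
      rw [this]
      exact hx t
    · have : (fun s => g' (T s x)) = fun _ => 0 := by
        ext s
        rw [hg', Set.indicator_of_notMem]
        intro h
        have := hYinv _ h (-s)
        rw [← hT.add_apply, neg_add_cancel, hT.zero_apply] at this
        exact hx this
      rw [this]
      exact intervalIntegrable_const
  have hgi : Integrable g' μ := hf.congr hfg'
  have hg0 : ∫ x, g' x ∂μ = 0 := by rw [← integral_congr_ae hfg', hf0]
  have h1 := hT.ae_returnsWithZeroIntegral_of_pos he hright hcont hg'm hgi hg0 hloc
  have h2 := hT.ae_returnsWithZeroIntegral_of_pos he hright hcont (f := fun x => -g' x)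
    hg'm.neg hgi.neg (by rw [integral_neg, hg0, neg_zero]) fun x t => (hloc x t).neg
  filter_upwards [h1, h2, hfg', hT.ae_intervalIntegrable hp hf, hT.ae_integral_congr hp hfg']
    with x hx1 hx2 hx3 hx4 hx5
  refine ⟨hx4, fun hne => ?_⟩
  rw [hx3] at hne
  rcases lt_or_gt_of_ne hne with hneg | hpos
  · obtain ⟨t, ht1, ht2, ht3⟩ := hx2 (neg_pos.2 hneg)
    refine ⟨t, ht1, fun k => ?_, ht3⟩
    have := ht2 k
    rw [orbitIntegral, intervalIntegral.integral_neg, neg_eq_zero, ← hx5] at this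
    exact this
  · obtain ⟨t, ht1, ht2, ht3⟩ := hx1 hpos
    refine ⟨t, ht1, fun k => ?_, ht3⟩
    have := ht2 k
    rw [orbitIntegral, ← hx5] at this
    exact this

end IsMeasurableFlow

/-! ### Linear flows on the torus -/

theorem isMeasurableFlow_torusFlow {d : ℕ} (ω : Fin d → ℝ) : IsMeasurableFlow (torusFlow ω) where
  measurable := by
    refine Continuous.measurable ?_
    refine continuous_pi fun i => ?_
    exact ((continuous_apply i).comp continuous_snd).add
      ((AddCircle.continuous_mk' 1).comp (continuous_fst.mul continuous_const))
  zero_apply x := by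
    ext i
    simp [torusFlow]
  add_apply s t x := by
    ext i
    simp only [torusFlow, add_mul, AddCircle.coe_add]
    abel

theorem continuous_torusFlow_orbit {d : ℕ} (ω : Fin d → ℝ) (x : UnitAddTorus (Fin d)) :
    Continuous fun t => torusFlow ω t x := by
  refine continuous_pi fun i => ?_
  exact continuous_const.add
    ((AddCircle.continuous_mk' 1).comp (continuous_id.mul continuous_const))

/-! ### Special flows -/

namespace SpecialFlow

variable {A : Set ℝ} {P : A ≃ᵐ A} {r : A → ℝ}

theorem basePow_zero (a : A) : basePow P 0 a = a := by simp [basePow]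

theorem basePow_add (m n : ℤ) (a : A) : basePow P (m + n) a = basePow P m (basePow P n a) := by
  simp [basePow, zpow_add]

theorem measurable_basePow (n : ℤ) : Measurable (basePow P n) := by
  induction n using Int.induction_on with
  | zero =>
    simp only [funext basePow_zero]
    exact measurable_id
  | succ i ih =>
    have : basePow P (i + 1) = fun a => P (basePow P i a) := by
      ext a
      rw [add_comm, basePow_add]
      simp [basePow]
    rw [this]
    exact P.measurable.comp ih
  | pred i ih =>
    have : basePow P (-i - 1) = fun a => P.symm (basePow P (-i) a) := by
      ext a
      rw [sub_eq_add_neg, add_comm, basePow_add]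
      simp [basePow]
    rw [this]
    exact P.symm.measurable.comp ih

theorem arrivalTime_zero (a : A) : arrivalTime P r 0 a = 0 := by simp [arrivalTime]

theorem arrivalTime_add_one (n : ℤ) (a : A) :
    arrivalTime P r (n + 1) a = arrivalTime P r n a + r (basePow P n a) := by
  unfold arrivalTime
  rcases le_or_gt 0 n with h | h
  · have h1 : Finset.Ico 0 (n + 1) = insert n (Finset.Ico 0 n) := by
      ext i
      simp only [Finset.mem_Ico, Finset.mem_insert]
      omega
    rw [h1, Finset.sum_insert (by simp), Finset.Ico_eq_empty (by omega : ¬ n < 0),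
      Finset.Ico_eq_empty (by omega : ¬ n + 1 < 0)]
    ring
  · have h1 : Finset.Ico n 0 = insert n (Finset.Ico (n + 1) 0) := by
      ext i
      simp only [Finset.mem_Ico, Finset.mem_insert]
      omega
    rw [h1, Finset.sum_insert (by simp), Finset.Ico_eq_empty (by omega : ¬ 0 < n),
      Finset.Ico_eq_empty (by omega : ¬ 0 < n + 1)]
    ring

theorem arrivalTime_add (m n : ℤ) (a : A) :
    arrivalTime P r (m + n) a = arrivalTime P r n a + arrivalTime P r m (basePow P n a) := by
  induction m using Int.induction_on with
  | zero => rw [zero_add, arrivalTime_zero, add_zero]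
  | succ i ih =>
    rw [add_right_comm, arrivalTime_add_one, arrivalTime_add_one, ih, basePow_add]
    ring
  | pred i ih =>
    have h1 := arrivalTime_add_one (P := P) (r := r) (-i - 1 + n) a
    have h2 := arrivalTime_add_one (P := P) (r := r) (-i - 1) (basePow P n a)
    rw [add_right_comm, sub_add_cancel, ih, basePow_add] at h1
    rw [sub_add_cancel] at h2
    linarith

theorem monotone_arrivalTime (hr : ∀ a, 0 ≤ r a) (a : A) :
    Monotone fun n => arrivalTime P r n a :=
  monotone_int_of_le_succ fun n => by
    rw [arrivalTime_add_one]
    linarith [hr (basePow P n a)]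

theorem measurable_arrivalTime (hr : Measurable r) (n : ℤ) : Measurable (arrivalTime P r n) :=
  (Finset.measurable_fun_sum _ fun i _ => hr.comp (measurable_basePow i)).sub
    (Finset.measurable_fun_sum _ fun i _ => hr.comp (measurable_basePow i))

/-- At the time `t` the trajectory of `x` is above `P ^ n a`, where `a` is the base point of `x`. -/
def IsAbove (P : A ≃ᵐ A) (r : A → ℝ) (t : ℝ) (n : ℤ) (x : PhaseSpace r) : Prop :=
  0 ≤ x.1.2 + t - arrivalTime P r n x.1.1 ∧
    x.1.2 + t - arrivalTime P r n x.1.1 < r (basePow P n x.1.1)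

theorem isAbove_iff {t : ℝ} {n : ℤ} {x : PhaseSpace r} :
    IsAbove P r t n x ↔ arrivalTime P r n x.1.1 ≤ x.1.2 + t ∧
      x.1.2 + t < arrivalTime P r (n + 1) x.1.1 := by
  rw [IsAbove, arrivalTime_add_one, sub_nonneg, sub_lt_iff_lt_add']

theorem IsAbove.unique (hr : ∀ a, 0 ≤ r a) {t : ℝ} {m n : ℤ} {x : PhaseSpace r}
    (hm : IsAbove P r t m x) (hn : IsAbove P r t n x) : m = n := by
  rw [isAbove_iff] at hm hn
  have aux : ∀ i j : ℤ, arrivalTime P r i x.1.1 ≤ x.1.2 + t →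
      x.1.2 + t < arrivalTime P r (j + 1) x.1.1 → i ≤ j := by
    intro i j hi hj
    by_contra h
    have := monotone_arrivalTime (P := P) hr x.1.1 (by omega : j + 1 ≤ i)
    simp only at this
    linarith
  exact le_antisymm (aux m n hm.1 hn.2) (aux n m hn.1 hm.2)

theorem flow_val_of_isAbove (hr : ∀ a, 0 ≤ r a) {t : ℝ} {n : ℤ} {x : PhaseSpace r}
    (h : IsAbove P r t n x) :
    (flow P r t x).1 = (basePow P n x.1.1, x.1.2 + t - arrivalTime P r n x.1.1) := by
  have hex : ∃ n : ℤ, 0 ≤ x.1.2 + t - arrivalTime P r n x.1.1 ∧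
      x.1.2 + t - arrivalTime P r n x.1.1 < r (basePow P n x.1.1) := ⟨n, h⟩
  have hn : hex.choose = n := IsAbove.unique hr hex.choose_spec h
  rw [flow, dif_pos hex]
  simp only [hn]

theorem flow_of_not_isAbove {t : ℝ} {x : PhaseSpace r} (h : ¬ ∃ n, IsAbove P r t n x) :
    flow P r t x = x :=
  dif_neg h

theorem isAbove_flow_iff (hr : ∀ a, 0 ≤ r a) {s t : ℝ} {m n : ℤ} {x : PhaseSpace r}
    (h : IsAbove P r s m x) :
    IsAbove P r t n (flow P r s x) ↔ IsAbove P r (s + t) (n + m) x := by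
  have e : x.1.2 + s - arrivalTime P r m x.1.1 + t - arrivalTime P r n (basePow P m x.1.1) =
      x.1.2 + (s + t) - arrivalTime P r (n + m) x.1.1 := by
    rw [arrivalTime_add]
    ring
  rw [IsAbove, IsAbove, flow_val_of_isAbove hr h, basePow_add, e]

theorem measurableSet_isAbove (hr : Measurable r) (n : ℤ) :
    MeasurableSet {p : ℝ × PhaseSpace r | IsAbove P r p.1 n p.2} := by
  have hfst : Measurable fun p : ℝ × PhaseSpace r => p.2.1.1 :=
    measurable_fst.comp (measurable_subtype_coe.comp measurable_snd)
  have hsnd : Measurable fun p : ℝ × PhaseSpace r => p.2.1.2 :=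
    measurable_snd.comp (measurable_subtype_coe.comp measurable_snd)
  have hpos : Measurable fun p : ℝ × PhaseSpace r =>
      p.2.1.2 + p.1 - arrivalTime P r n p.2.1.1 :=
    (hsnd.add measurable_fst).sub ((measurable_arrivalTime hr n).comp hfst)
  exact (measurableSet_le measurable_const hpos).inter
    (measurableSet_lt hpos (hr.comp ((measurable_basePow n).comp hfst)))

theorem measurableSet_exists_isAbove (hr : Measurable r) :
    MeasurableSet {p : ℝ × PhaseSpace r | ∃ n, IsAbove P r p.1 n p.2} := by
  simp only [Set.ofPred_exists]
  exact MeasurableSet.iUnion fun n => measurableSet_isAbove hr n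

theorem measurable_flow (hr : Measurable r) (hr0 : ∀ a, 0 ≤ r a) :
    Measurable fun p : ℝ × PhaseSpace r => flow P r p.1 p.2 := by
  refine Measurable.subtype_mk (f := fun p : ℝ × PhaseSpace r => (flow P r p.1 p.2).1) ?_
  intro W hW
  have hfst : Measurable fun p : ℝ × PhaseSpace r => p.2.1.1 :=
    measurable_fst.comp (measurable_subtype_coe.comp measurable_snd)
  have hsnd : Measurable fun p : ℝ × PhaseSpace r => p.2.1.2 :=
    measurable_snd.comp (measurable_subtype_coe.comp measurable_snd)
  have hpos : ∀ n, Measurable fun p : ℝ × PhaseSpace r =>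
      (basePow P n p.2.1.1, p.2.1.2 + p.1 - arrivalTime P r n p.2.1.1) := fun n =>
    ((measurable_basePow n).comp hfst).prodMk
      ((hsnd.add measurable_fst).sub ((measurable_arrivalTime hr n).comp hfst))
  have : (fun p : ℝ × PhaseSpace r => (flow P r p.1 p.2).1) ⁻¹' W =
      (⋃ n, {p | IsAbove P r p.1 n p.2} ∩ (fun p : ℝ × PhaseSpace r =>
        (basePow P n p.2.1.1, p.2.1.2 + p.1 - arrivalTime P r n p.2.1.1)) ⁻¹' W) ∪
      ({p | ∃ n, IsAbove P r p.1 n p.2}ᶜ ∩ (fun p => p.2.1) ⁻¹' W) := by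
    ext p
    by_cases h : ∃ n, IsAbove P r p.1 n p.2
    · obtain ⟨n, hn⟩ := h
      have h1 : ∀ m, IsAbove P r p.1 m p.2 → m = n := fun m hm => hm.unique hr0 hn
      simp only [Set.mem_preimage, flow_val_of_isAbove hr0 hn, Set.mem_union, Set.mem_iUnion,
        Set.mem_inter_iff, Set.mem_compl_iff, Set.mem_ofPred_eq]
      constructor
      · exact fun hW => Or.inl ⟨n, hn, hW⟩
      · rintro (⟨m, hm, hW⟩ | ⟨hno, -⟩)
        · rwa [h1 m hm] at hW
        · exact absurd ⟨n, hn⟩ hno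
    · simp only [Set.mem_preimage, flow_of_not_isAbove h, Set.mem_union, Set.mem_iUnion,
        Set.mem_inter_iff, Set.mem_compl_iff, Set.mem_ofPred_eq]
      constructor
      · exact fun hW => Or.inr ⟨h, hW⟩
      · rintro (⟨m, hm, -⟩ | ⟨-, hW⟩)
        · exact absurd ⟨m, hm⟩ h
        · exact hW
  rw [this]
  exact (MeasurableSet.iUnion fun n => (measurableSet_isAbove hr n).inter (hpos n hW)).union
    ((measurableSet_exists_isAbove hr).compl.inter
      ((measurable_subtype_coe.comp measurable_snd) hW))

/-- The set of points whose trajectory is defined at all times. -/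
def completeOrbits (P : A ≃ᵐ A) (r : A → ℝ) : Set (PhaseSpace r) :=
  {x | ∀ t, ∃ n, IsAbove P r t n x}

/-- The column at time t is the last one whose arrival time has passed. Such columns exist because
time s is reached, and their indices are bounded because time u is. -/
theorem exists_isAbove_of_mem_Icc (hr : ∀ a, 0 ≤ r a) {s t u : ℝ} {x : PhaseSpace r}
    (hs : ∃ n, IsAbove P r s n x) (hu : ∃ n, IsAbove P r u n x) (hst : s ≤ t) (htu : t ≤ u) :
    ∃ n, IsAbove P r t n x := by
  obtain ⟨m, hm⟩ := hs
  obtain ⟨n, hn⟩ := hu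
  rw [isAbove_iff] at hm hn
  obtain ⟨i, hi, hi'⟩ := Int.exists_greatest_of_bdd
    (P := fun i => arrivalTime P r i x.1.1 ≤ x.1.2 + t) ⟨n, fun z hz => by
      by_contra h
      have := monotone_arrivalTime (P := P) hr x.1.1 (by omega : n + 1 ≤ z)
      simp only at this
      linarith⟩ ⟨m, by linarith⟩
  refine ⟨i, isAbove_iff.2 ⟨hi, ?_⟩⟩
  by_contra h
  have := hi' (i + 1) (not_lt.1 h)
  omega

theorem measurableSet_completeOrbits (hr : Measurable r) (hr0 : ∀ a, 0 ≤ r a) :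
    MeasurableSet (completeOrbits P r) := by
  have : completeOrbits P r = ⋂ k : ℕ, ({x | ∃ n, IsAbove P r (-k) n x} ∩
      {x | ∃ n, IsAbove P r k n x}) := by
    ext x
    simp only [Set.mem_iInter, Set.mem_inter_iff]
    constructor
    · exact fun h k => ⟨h _, h _⟩
    · intro h t
      obtain ⟨k, hk⟩ := exists_nat_ge |t|
      obtain ⟨h1, h2⟩ := abs_le.1 hk
      exact exists_isAbove_of_mem_Icc hr0 (h k).1 (h k).2 h1 h2
  rw [this]
  have h : ∀ t, MeasurableSet {x | ∃ n, IsAbove P r t n x} := fun t =>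
    measurable_prodMk_left (measurableSet_exists_isAbove hr)
  exact MeasurableSet.iInter fun k => (h _).inter (h _)

theorem flow_mem_completeOrbits_iff (hr : ∀ a, 0 ≤ r a) (t : ℝ) (x : PhaseSpace r) :
    flow P r t x ∈ completeOrbits P r ↔ x ∈ completeOrbits P r := by
  by_cases h : ∃ n, IsAbove P r t n x
  · obtain ⟨m, hm⟩ := h
    constructor
    · intro hx s
      obtain ⟨n, hn⟩ := hx (s - t)
      rw [isAbove_flow_iff hr hm, add_sub_cancel] at hn
      exact ⟨_, hn⟩
    · intro hx s
      obtain ⟨n, hn⟩ := hx (t + s)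
      refine ⟨n - m, ?_⟩
      rwa [isAbove_flow_iff hr hm, sub_add_cancel]
  · rw [flow_of_not_isAbove h]

theorem isAbove_zero {t : ℝ} {x : PhaseSpace r} (h0 : 0 ≤ x.1.2 + t) (h1 : x.1.2 + t < r x.1.1) :
    IsAbove P r t 0 x := by
  rw [IsAbove, arrivalTime_zero, basePow_zero, sub_zero]
  exact ⟨h0, h1⟩

theorem flow_zero (hr : ∀ a, 0 ≤ r a) (x : PhaseSpace r) : flow P r 0 x = x := by
  have h : IsAbove P r 0 0 x := isAbove_zero (by simpa using x.2.1) (by simpa using x.2.2)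
  apply Subtype.ext
  rw [flow_val_of_isAbove hr h, basePow_zero, arrivalTime_zero, add_zero, sub_zero]

theorem flow_add (hr : ∀ a, 0 ≤ r a) {x : PhaseSpace r} (hx : x ∈ completeOrbits P r) (s t : ℝ) :
    flow P r (s + t) x = flow P r s (flow P r t x) := by
  obtain ⟨m, hm⟩ := hx t
  obtain ⟨n, hn⟩ := (flow_mem_completeOrbits_iff hr t x).2 hx s
  have h := (isAbove_flow_iff hr hm).1 hn
  rw [add_comm t s] at h
  apply Subtype.ext
  rw [flow_val_of_isAbove hr h, flow_val_of_isAbove hr hn, flow_val_of_isAbove hr hm,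
    basePow_add, arrivalTime_add]
  ring_nf

open Classical in
/-- The special flow, made to act trivially on the points whose trajectory is not defined at all
times. -/
noncomputable def completeFlow (P : A ≃ᵐ A) (r : A → ℝ) (t : ℝ) (x : PhaseSpace r) :
    PhaseSpace r :=
  if x ∈ completeOrbits P r then flow P r t x else x

theorem completeFlow_of_mem {x : PhaseSpace r} (hx : x ∈ completeOrbits P r) (t : ℝ) :
    completeFlow P r t x = flow P r t x :=
  if_pos hx

theorem completeFlow_of_notMem {x : PhaseSpace r} (hx : x ∉ completeOrbits P r) (t : ℝ) :
    completeFlow P r t x = x :=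
  if_neg hx

/-- The group law is available for `flow` on complete orbits, which form an invariant set, and it is
trivial on the frozen points. -/
theorem isMeasurableFlow_completeFlow (hr : Measurable r) (hr0 : ∀ a, 0 ≤ r a) :
    IsMeasurableFlow (completeFlow P r) where
  measurable := by
    classical
    exact Measurable.ite (measurable_snd (measurableSet_completeOrbits hr hr0))
      (measurable_flow hr hr0) measurable_snd
  zero_apply x := by
    by_cases hx : x ∈ completeOrbits P r
    · rw [completeFlow_of_mem hx, flow_zero hr0]
    · rw [completeFlow_of_notMem hx]
  add_apply s t x := by
    by_cases hx : x ∈ completeOrbits P r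
    · rw [completeFlow_of_mem hx, completeFlow_of_mem hx,
        completeFlow_of_mem ((flow_mem_completeOrbits_iff hr0 t x).2 hx), flow_add hr0 hx]
    · simp only [completeFlow_of_notMem hx]

/-- For small times the point stays in its own column unless it drops below the base. This covers
right limits everywhere and two-sided limits at positive height. -/
theorem continuousWithinAt_completeFlow (hr : ∀ a, 0 ≤ r a) (x : PhaseSpace r) {s : Set ℝ}
    (hs : ∀ᶠ t in 𝓝[s] (0 : ℝ), 0 ≤ x.1.2 + t) :
    ContinuousWithinAt (fun t => completeFlow P r t x) s 0 := by
  by_cases hx : x ∈ completeOrbits P r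
  · simp only [completeFlow_of_mem hx]
    rw [ContinuousWithinAt, flow_zero hr, tendsto_subtype_rng]
    have h1 : Tendsto (fun t : ℝ => (x.1.1, x.1.2 + t)) (𝓝[s] 0) (𝓝 x.1) := by
      have : Continuous fun t : ℝ => (x.1.1, x.1.2 + t) := by fun_prop
      have h2 := this.tendsto 0
      rw [add_zero] at h2
      exact h2.mono_left nhdsWithin_le_nhds
    refine h1.congr' ?_
    have h3 : ∀ᶠ t in 𝓝[s] (0 : ℝ), x.1.2 + t < r x.1.1 := by
      have h4 : Tendsto (fun t : ℝ => x.1.2 + t) (𝓝[s] 0) (𝓝 x.1.2) :=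
        (continuous_snd.tendsto _).comp h1
      exact h4.eventually (gt_mem_nhds x.2.2)
    filter_upwards [hs, h3] with t ht1 ht2
    rw [flow_val_of_isAbove hr (isAbove_zero ht1 ht2), basePow_zero, arrivalTime_zero, sub_zero]
  · simp only [completeFlow_of_notMem hx]
    exact continuousWithinAt_const

variable {ν : Measure A}

theorem measurableSet_phaseSpace (hr : Measurable r) :
    MeasurableSet {p : A × ℝ | 0 ≤ p.2 ∧ p.2 < r p.1} :=
  (measurableSet_le measurable_const measurable_snd).inter
    (measurableSet_lt measurable_snd (hr.comp measurable_fst))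

theorem phaseMeasure_apply (hr : Measurable r) (s : Set (PhaseSpace r)) :
    phaseMeasure ν r s = ν.prod volume (Subtype.val '' s) :=
  (MeasurableEmbedding.subtype_coe (measurableSet_phaseSpace hr)).comap_apply _ s

theorem isFiniteMeasure_phaseMeasure (hr : Measurable r) (hi : Integrable r ν) :
    IsFiniteMeasure (phaseMeasure ν r) := by
  constructor
  have hm := measurableSet_phaseSpace hr
  rw [phaseMeasure_apply hr, Set.image_univ, Subtype.range_coe_subtype,
    Measure.prod_apply hm]
  refine lt_of_le_of_lt (le_of_eq ?_) hi.lintegral_lt_top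
  refine lintegral_congr fun a => ?_
  have : Prod.mk a ⁻¹' {p : A × ℝ | 0 ≤ p.2 ∧ p.2 < r p.1} = Set.Ico 0 (r a) := by
    ext b
    rfl
  rw [this, Real.volume_Ico, sub_zero]

theorem ae_height_pos (hr : Measurable r) : ∀ᵐ x ∂phaseMeasure ν r, 0 < x.1.2 := by
  rw [ae_iff, phaseMeasure_apply hr]
  refine measure_mono_null (t := Set.univ ×ˢ {0}) ?_ (by simp [Measure.prod_prod])
  rintro _ ⟨x, hx, rfl⟩
  exact ⟨trivial, le_antisymm (not_lt.1 hx) x.2.1⟩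

/-- If the special flow preserves the measure, then almost every trajectory is defined at all
times: the points whose trajectory is not defined at the time `t` are left in place by `flow P r t`,
so no other point can be carried to such a point. -/
theorem ae_mem_completeOrbits (hr : Measurable r) (hr0 : ∀ a, 0 ≤ r a) (hi : Integrable r ν)
    (hp : ∀ t, MeasurePreserving (flow P r t) (phaseMeasure ν r) (phaseMeasure ν r)) :
    ∀ᵐ x ∂phaseMeasure ν r, x ∈ completeOrbits P r := by
  have := isFiniteMeasure_phaseMeasure hr hi
  have hdouble : ∀ᵐ x ∂phaseMeasure ν r, ∀ q : ℚ,
      (∃ n, IsAbove P r q n x) → ∃ n, IsAbove P r (2 * q) n x := by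
    rw [ae_all_iff]
    intro q
    set N : Set (PhaseSpace r) := {x | ∃ n, IsAbove P r q n x}ᶜ with hN
    have hNm : MeasurableSet N :=
      (measurable_prodMk_left (measurableSet_exists_isAbove hr) :
        MeasurableSet {x | ∃ n, IsAbove P r q n x}).compl
    have hsub : N ⊆ flow P r q ⁻¹' N := by
      intro x hx
      rw [Set.mem_preimage, flow_of_not_isAbove hx]
      exact hx
    -- Points of N are fixed at time q, so N lies in its preimage, which has the same finite
    -- measure. Almost no point outside N can therefore enter N, and one that stays outside can move
    -- for another time q.
    have heq := ae_eq_of_subset_of_measure_ge hsub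
      ((hp q).measure_preimage hNm.nullMeasurableSet).le hNm.nullMeasurableSet (measure_ne_top _ _)
    filter_upwards [heq.mem_iff] with x hx h
    have h1 : ∃ n, IsAbove P r q n (flow P r q x) := by
      by_contra hn
      exact hx.2 hn h
    obtain ⟨m, hm⟩ := h
    obtain ⟨n, hn⟩ := h1
    rw [isAbove_flow_iff hr0 hm, ← two_mul] at hn
    exact ⟨_, hn⟩
  filter_upwards [hdouble, ae_height_pos hr] with x hx hpos t
  -- At ±q the point is still in its own column. Doubling reaches ±2^k q, and all times in between
  -- are then defined.
  obtain ⟨q, hq0, hq⟩ := exists_rat_btwn (show 0 < min x.1.2 (r x.1.1 - x.1.2) from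
    lt_min hpos (sub_pos.2 x.2.2))
  rw [lt_min_iff] at hq
  have hpow : ∀ k : ℕ, (∃ n, IsAbove P r (2 ^ k * q) n x) ∧
      ∃ n, IsAbove P r (-(2 ^ k * q)) n x := by
    intro k
    induction k with
    | zero =>
      rw [pow_zero, one_mul]
      exact ⟨⟨0, isAbove_zero (by linarith) (by linarith)⟩,
        ⟨0, isAbove_zero (by linarith) (by linarith)⟩⟩
    | succ k ih =>
      have h1 := hx (2 ^ k * q) (by push_cast; exact ih.1)
      have h2 := hx (-(2 ^ k * q)) (by push_cast; exact ih.2)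
      push_cast at h1 h2
      rw [pow_succ', mul_assoc]
      rw [mul_neg] at h2
      exact ⟨h1, h2⟩
  obtain ⟨k, hk⟩ := pow_unbounded_of_one_lt (|t| / q) (one_lt_two (α := ℝ))
  rw [div_lt_iff₀ hq0] at hk
  obtain ⟨h1, h2⟩ := abs_le.1 hk.le
  exact exists_isAbove_of_mem_Icc hr0 (hpow k).2 (hpow k).1 h1 h2

theorem isErgodicFlow_completeFlow (hr : Measurable r) (hr0 : ∀ a, 0 ≤ r a) (hi : Integrable r ν)
    (he : IsErgodicFlow (flow P r) (phaseMeasure ν r)) :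
    IsErgodicFlow (completeFlow P r) (phaseMeasure ν r) where
  measurePreserving t := by
    refine ⟨(isMeasurableFlow_completeFlow hr hr0).measurable_apply t, ?_⟩
    refine (Measure.map_congr ?_).trans (he.measurePreserving t).map_eq
    filter_upwards [ae_mem_completeOrbits hr hr0 hi he.measurePreserving] with x hx
    exact completeFlow_of_mem hx t
  null_or_conull s hs hinv := by
    have hG := ae_mem_completeOrbits hr hr0 hi he.measurePreserving
    -- Intersecting with the complete orbits, where the two flows agree, turns a set invariant under
    -- the frozen flow into one invariant under the original flow.
    refine (he.null_or_conull (s ∩ completeOrbits P r)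
      (hs.inter (measurableSet_completeOrbits hr hr0)) fun t => ?_).imp (fun h => ?_) fun h => ?_
    · ext x
      simp only [Set.mem_preimage, Set.mem_inter_iff, flow_mem_completeOrbits_iff hr0]
      refine and_congr_left fun hx => ?_
      rw [← completeFlow_of_mem hx, ← Set.mem_preimage, hinv t]
    · rw [measure_eq_zero_iff_ae_notMem] at h ⊢
      filter_upwards [h, hG] with x h1 h2 h3 using h1 ⟨h3, h2⟩
    · exact measure_mono_null (Set.compl_subset_compl.2 Set.inter_subset_left) h

theorem ae_returnsWithZeroIntegral (hr : Measurable r) (hr0 : ∀ a, 0 ≤ r a) (hi : Integrable r ν)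
    (he : IsErgodicFlow (flow P r) (phaseMeasure ν r)) {f : PhaseSpace r → ℝ}
    (hf : Integrable f (phaseMeasure ν r)) (hf0 : ∫ x, f x ∂phaseMeasure ν r = 0) :
    ∀ᵐ x ∂phaseMeasure ν r,
      (∀ t, IntervalIntegrable (fun s => f (flow P r s x)) volume 0 t) ∧
      (f x ≠ 0 → ReturnsWithZeroIntegral (flow P r) f x) := by
  have := isFiniteMeasure_phaseMeasure hr hi
  have hcont : ∀ᵐ x ∂phaseMeasure ν r, ContinuousAt (fun t => completeFlow P r t x) 0 := by
    filter_upwards [ae_height_pos hr] with x hx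
    rw [← continuousWithinAt_univ]
    refine continuousWithinAt_completeFlow hr0 x ?_
    rw [nhdsWithin_univ]
    filter_upwards [lt_mem_nhds (neg_lt_zero.2 hx)] with t ht
    linarith
  have hright : ∀ x, ContinuousWithinAt (fun t => completeFlow P r t x) (Set.Ioi 0) 0 := fun x =>
    continuousWithinAt_completeFlow hr0 x (eventually_nhdsWithin_of_forall fun t ht =>
      add_nonneg x.2.1 (le_of_lt ht))
  filter_upwards [(isMeasurableFlow_completeFlow hr hr0).ae_returnsWithZeroIntegral
    (isErgodicFlow_completeFlow hr hr0 hi he) hright hcont hf hf0,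
    ae_mem_completeOrbits hr hr0 hi he.measurePreserving] with x hx hxG
  simpa only [ReturnsWithZeroIntegral, orbitIntegral, completeFlow_of_mem hxG] using hx

end SpecialFlow

theorem theoremB :
    (∀ (A : Set ℝ), MeasurableSet A →
      ∀ (ν : Measure A) [SigmaFinite ν] (P : A ≃ᵐ A), MeasurePreserving P ν ν →
      ∀ r : A → ℝ, Measurable r → (∀ a, 0 ≤ r a) → Integrable r ν →
      IsErgodicFlow (SpecialFlow.flow P r) (SpecialFlow.phaseMeasure ν r) →
      ∀ f : SpecialFlow.PhaseSpace r → ℝ, Integrable f (SpecialFlow.phaseMeasure ν r) →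
      ∫ x, f x ∂(SpecialFlow.phaseMeasure ν r) = 0 →
      ∀ᵐ x ∂(SpecialFlow.phaseMeasure ν r),
        (∀ t : ℝ, IntervalIntegrable (fun s => f (SpecialFlow.flow P r s x)) volume 0 t) ∧
        (f x ≠ 0 → ReturnsWithZeroIntegral (SpecialFlow.flow P r) f x)) ∧
    (∀ (d : ℕ) (ω : Fin d → ℝ),
      IsErgodicFlow (torusFlow ω) (volume : Measure (UnitAddTorus (Fin d))) →
      ∀ f : UnitAddTorus (Fin d) → ℝ, Integrable f volume → ∫ x, f x = 0 →
      ∀ᵐ x : UnitAddTorus (Fin d),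
        (∀ t : ℝ, IntervalIntegrable (fun s => f (torusFlow ω s x)) volume 0 t) ∧
        (f x ≠ 0 → ReturnsWithZeroIntegral (torusFlow ω) f x)) := by
  refine ⟨?_, ?_⟩
  · intro A _ ν _ P _ r hr hr0 hi he f hf hf0
    exact SpecialFlow.ae_returnsWithZeroIntegral hr hr0 hi he hf hf0
  · intro d ω he f hf hf0
    exact (isMeasurableFlow_torusFlow ω).ae_returnsWithZeroIntegral he
      (fun x => (continuous_torusFlow_orbit ω x).continuousWithinAt)
      (Eventually.of_forall fun x => (continuous_torusFlow_orbit ω x).continuousAt) hf hf0
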